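/- Let $H'=\mathrm{Pol}(SO_{-1}(3))$ be the Hopf $*$-algebra of the compact quantum group $SO_{-1}(3)$: the universal unital complex $*$-algebra generated by self-adjoint elements $a_{ij}$ ($1\le i,j\le 3$) such that, with $A=(a_{ij})$, (1) $AA^{\top}=A^{\top}A=1$; (2) $a_{ij}a_{ik}=-a_{ik}a_{ij}$ for $j\ne k$; (3) $a_{ij}a_{kj}=-a_{kj}a_{ij}$ for $i\neq k$; (4) $a_{ij}a_{kl}=a_{kl}a_{ij}$ for $i\ne k$, $j\ne l$; (5) $\sum_{\sigma\in S_3}a_{1\sigma(1)}a_{2\sigma(2)}a_{3\sigma(3)}=1$; with $\Delta(a_{ij})=\sum_k a_{ik}\otimes a_{kj}$, $\varepsilon(a_{ij})=\delta_{ij}$, $S(a_{ij})=a_{ji}$. An automorphism of $SO_{-1}(3)$ is a bijective Hopf $*$-algebra homomorphism $H'\to H'$; these form a group $\mathrm{Aut}(SO_{-1}(3))$ under composition. Let $\rho:S_4\to O(3)$ be the permutation representation of $S_4$ on $(1,1,1,1)^{\perp}\subset\mathbb R^4$, written in the orthonormal basis $\tfrac12(1,1,-1,-1)$, $\tfrac12(1,-1,1,-1)$,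 $\tfrac12(1,-1,-1,1)$. Theorem. Every automorphism $\theta$ of $SO_{-1}(3)$ is given by $A\mapsto\rho(x)^{\top}A\rho(x)$ for some $x\in S_4$, i.e. $(\theta(a_{ij}))_{ij}=\rho(x)^{\top}A\rho(x)$. Moreover, for every $x\in S_4$ this formula defines an automorphism of $SO_{-1}(3)$, and the resulting map $S_4\to\mathrm{Aut}(SO_{-1}(3))$ is an isomorphism of groups; in particular $\mathrm{Aut}(SO_{-1}(3))\cong S_4$. -/

import Mathlib

open scoped Matrix TensorProduct

/-- The defining relations of `SO_{-1}(3)` for a `3 × 3` matrix over a ring: orthogonality,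
(anti)commutation, and the quantum determinant (a permanent) being `1`. -/
structure SOm3Relations {B : Type*} [Ring B] (u : Matrix (Fin 3) (Fin 3) B) : Prop where
  mul_transpose : u * uᵀ = 1
  transpose_mul : uᵀ * u = 1
  anticomm_row : ∀ i j k, k ≠ j → u i j * u i k = -(u i k * u i j)
  anticomm_col : ∀ i j k, k ≠ i → u i j * u k j = -(u k j * u i j)
  comm : ∀ i j k l, i ≠ k → j ≠ l → u i j * u k l = u k l * u i j
  perm_eq_one : ∑ σ : Equiv.Perm (Fin 3), u 0 (σ 0) * u 1 (σ 1) * u 2 (σ 2) = 1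

namespace SOm3Relations

theorem sum_perm {B : Type*} [AddCommMonoid B] (f : Fin 3 → Fin 3 → Fin 3 → B) :
    ∑ σ : Equiv.Perm (Fin 3), f (σ 0) (σ 1) (σ 2) =
      f 0 1 2 + f 0 2 1 + f 1 0 2 + f 1 2 0 + f 2 0 1 + f 2 1 0 := by
  have h : (Finset.univ : Finset (Equiv.Perm (Fin 3))) =
      {1, Equiv.swap 1 2, Equiv.swap 0 1, Equiv.swap 0 1 * Equiv.swap 1 2,
        Equiv.swap 1 2 * Equiv.swap 0 1, Equiv.swap 0 2} := by decide
  rw [h, Finset.sum_insert (by decide), Finset.sum_insert (by decide),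
    Finset.sum_insert (by decide), Finset.sum_insert (by decide),
    Finset.sum_insert (by decide), Finset.sum_singleton]
  have : ∀ σ : Equiv.Perm (Fin 3), ∀ a b c, σ 0 = a → σ 1 = b → σ 2 = c →
      f (σ 0) (σ 1) (σ 2) = f a b c := by rintro σ _ _ _ rfl rfl rfl; rfl
  rw [this 1 0 1 2 (by decide) (by decide) (by decide),
    this (Equiv.swap 1 2) 0 2 1 (by decide) (by decide) (by decide),
    this (Equiv.swap 0 1) 1 0 2 (by decide) (by decide) (by decide),
    this (Equiv.swap 0 1 * Equiv.swap 1 2) 1 2 0 (by decide) (by decide) (by decide),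
    this (Equiv.swap 1 2 * Equiv.swap 0 1) 2 0 1 (by decide) (by decide) (by decide),
    this (Equiv.swap 0 2) 2 1 0 (by decide) (by decide) (by decide)]
  abel

variable {B : Type*} [Ring B] {u v : Matrix (Fin 3) (Fin 3) B}

theorem map {C : Type*} [Ring C] (hu : SOm3Relations u) (f : B →+* C) :
    SOm3Relations (u.map f) where
  mul_transpose := by
    rw [← Matrix.transpose_map, ← Matrix.map_mul, hu.mul_transpose, Matrix.map_one _ (map_zero f) (map_one f)]
  transpose_mul := by
    rw [← Matrix.transpose_map, ← Matrix.map_mul, hu.transpose_mul, Matrix.map_one _ (map_zero f) (map_one f)]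
  anticomm_row i j k h := by
    simpa using congrArg f (hu.anticomm_row i j k h)
  anticomm_col i j k h := by
    simpa using congrArg f (hu.anticomm_col i j k h)
  comm i j k l h h' := by
    simpa using congrArg f (hu.comm i j k l h h')
  perm_eq_one := by
    simpa using congrArg f hu.perm_eq_one

theorem one : SOm3Relations (1 : Matrix (Fin 3) (Fin 3) B) where
  mul_transpose := by simp
  transpose_mul := by simp
  anticomm_row i j k h := by
    by_cases h1 : i = j <;> by_cases h2 : i = k <;> simp_all [Matrix.one_apply]
  anticomm_col i j k h := by
    by_cases h1 : i = j <;> by_cases h2 : k = j <;> simp_all [Matrix.one_apply]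
  comm i j k l h h' := by
    by_cases h1 : i = j <;> by_cases h2 : k = l <;> simp_all [Matrix.one_apply]
  perm_eq_one := by
    rw [sum_perm fun a b c => (1 : Matrix (Fin 3) (Fin 3) B) 0 a * (1 : Matrix (Fin 3) (Fin 3) B) 1 b
      * (1 : Matrix (Fin 3) (Fin 3) B) 2 c]
    simp

/-- Products of entries from distinct rows and columns can be put in the order of the rows. -/
theorem reorder (hu : SOm3Relations u) :
    (∀ a b c, a ≠ b → a ≠ c → b ≠ c → u 1 b * u 0 a * u 2 c = u 0 a * u 1 b * u 2 c) ∧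
    (∀ a b c, a ≠ b → a ≠ c → b ≠ c → u 0 a * u 2 c * u 1 b = u 0 a * u 1 b * u 2 c) ∧
    (∀ a b c, a ≠ b → a ≠ c → b ≠ c → u 1 b * u 2 c * u 0 a = u 0 a * u 1 b * u 2 c) ∧
    (∀ a b c, a ≠ b → a ≠ c → b ≠ c → u 2 c * u 0 a * u 1 b = u 0 a * u 1 b * u 2 c) ∧
    (∀ a b c, a ≠ b → a ≠ c → b ≠ c → u 2 c * u 1 b * u 0 a = u 0 a * u 1 b * u 2 c) := by
  refine ⟨?_, ?_, ?_, ?_, ?_⟩ <;> intro a b c hab hac hbc <;>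
    have h1 := hu.comm 1 b 0 a (by decide) hab.symm <;>
    have h2 := hu.comm 2 c 0 a (by decide) hac.symm <;>
    have h3 := hu.comm 2 c 1 b (by decide) hbc.symm
  · rw [h1]
  · rw [mul_assoc, h3, ← mul_assoc]
  · rw [mul_assoc, h2, ← mul_assoc, h1]
  · rw [h2, mul_assoc, h3, ← mul_assoc]
  · rw [h3, mul_assoc, h2, ← mul_assoc, h1]

theorem perm_rows (hu : SOm3Relations u) (p q r : Fin 3) :
    ∑ σ : Equiv.Perm (Fin 3), u p (σ 0) * u q (σ 1) * u r (σ 2) =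
      if p ≠ q ∧ q ≠ r ∧ p ≠ r then 1 else 0 := by
  rw [sum_perm fun a b c => u p a * u q b * u r c]
  by_cases hpq : p = q
  · subst hpq
    rw [if_neg (by tauto), hu.anticomm_row p 0 1 (by decide), hu.anticomm_row p 0 2 (by decide),
      hu.anticomm_row p 1 2 (by decide)]
    noncomm_ring
  by_cases hqr : q = r
  · subst hqr
    rw [if_neg (by tauto)]
    simp only [mul_assoc]
    rw [hu.anticomm_row q 0 1 (by decide), hu.anticomm_row q 0 2 (by decide),
      hu.anticomm_row q 1 2 (by decide)]
    noncomm_ring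
  by_cases hpr : p = r
  · subst hpr
    rw [if_neg (by tauto)]
    have e : ∀ a b c, a ≠ b → a ≠ c → b ≠ c →
        u p a * u q b * u p c = -(u p c * u q b * u p a) := by
      intro a b c hab hac hbc
      rw [hu.comm p a q b hpq hab, mul_assoc, hu.anticomm_row p a c hac.symm, mul_neg, ← mul_assoc,
        hu.comm q b p c (Ne.symm hpq) hbc]
    rw [e 0 1 2 (by decide) (by decide) (by decide), e 0 2 1 (by decide) (by decide) (by decide),
      e 1 0 2 (by decide) (by decide) (by decide)]
    abel
  rw [if_pos ⟨hpq, hqr, hpr⟩]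
  have h1 := hu.perm_eq_one
  rw [sum_perm fun a b c => u 0 a * u 1 b * u 2 c] at h1
  obtain ⟨h102, h021, h120, h201, h210⟩ := hu.reorder
  rw [← h1]
  fin_cases p <;> fin_cases q <;> fin_cases r <;> simp at hpq hqr hpr <;>
    simp [h102, h021, h120, h201, h210] <;> abel

theorem transpose (hu : SOm3Relations u) : SOm3Relations uᵀ where
  mul_transpose := hu.transpose_mul
  transpose_mul := hu.mul_transpose
  anticomm_row i j k h := hu.anticomm_col j i k h
  anticomm_col i j k h := hu.anticomm_row j i k h
  comm i j k l h h' := hu.comm j i l k h' h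
  perm_eq_one := by
    have := hu.perm_eq_one
    rw [sum_perm fun a b c => u 0 a * u 1 b * u 2 c] at this
    rw [sum_perm fun a b c => uᵀ 0 a * uᵀ 1 b * uᵀ 2 c, ← this]
    simp only [Matrix.transpose_apply]
    obtain ⟨h102, h021, h120, h201, h210⟩ := hu.reorder
    simp [h102, h021, h120, h201, h210]
    abel

theorem op (hu : SOm3Relations u) : SOm3Relations (u.map MulOpposite.op) where
  mul_transpose := by
    ext i j
    have := congrFun (congrFun hu.mul_transpose j) i
    apply MulOpposite.unop_injective
    simpa [Matrix.mul_apply, Matrix.one_apply, eq_comm, apply_ite MulOpposite.unop] using this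
  transpose_mul := by
    ext i j
    have := congrFun (congrFun hu.transpose_mul j) i
    apply MulOpposite.unop_injective
    simpa [Matrix.mul_apply, Matrix.one_apply, eq_comm, apply_ite MulOpposite.unop] using this
  anticomm_row i j k h := by
    apply MulOpposite.unop_injective
    simpa using hu.anticomm_row i k j h.symm
  anticomm_col i j k h := by
    apply MulOpposite.unop_injective
    simpa using hu.anticomm_col k j i h.symm
  comm i j k l h h' := by
    apply MulOpposite.unop_injective
    simpa using hu.comm k l i j h.symm h'.symm
  perm_eq_one := by
    apply MulOpposite.unop_injective
    have := hu.perm_eq_one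
    rw [sum_perm fun a b c => u 0 a * u 1 b * u 2 c] at this
    rw [sum_perm fun a b c => (u.map MulOpposite.op) 0 a * (u.map MulOpposite.op) 1 b
      * (u.map MulOpposite.op) 2 c]
    simp only [Matrix.map_apply, ← MulOpposite.op_mul,
      ← MulOpposite.op_add, MulOpposite.unop_op, MulOpposite.unop_one]
    rw [← this]
    obtain ⟨h102, h021, h120, h201, h210⟩ := hu.reorder
    simp [← mul_assoc, h210]

theorem mul (hu : SOm3Relations u) (hv : SOm3Relations v)
    (h : ∀ i j k l, u i j * v k l = v k l * u i j) : SOm3Relations (u * v) where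
  mul_transpose := by
    have : (u * v)ᵀ = vᵀ * uᵀ := by
      ext i j; simp [Matrix.mul_apply, h]
    rw [this, Matrix.mul_assoc, ← Matrix.mul_assoc v, hv.mul_transpose, Matrix.one_mul, hu.mul_transpose]
  transpose_mul := by
    have : (u * v)ᵀ = vᵀ * uᵀ := by
      ext i j; simp [Matrix.mul_apply, h]
    rw [this, Matrix.mul_assoc, ← Matrix.mul_assoc uᵀ, hu.transpose_mul, Matrix.one_mul, hv.transpose_mul]
  anticomm_row i j k hjk := by
    simp only [Matrix.mul_apply, Finset.sum_mul_sum]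
    rw [Finset.sum_comm, ← Finset.sum_neg_distrib]
    refine Finset.sum_congr rfl fun p _ => ?_
    rw [← Finset.sum_neg_distrib]
    refine Finset.sum_congr rfl fun q _ => ?_
    have e1 : u i q * v q j * (u i p * v p k) = (u i q * u i p) * (v q j * v p k) := by
      simp only [mul_assoc]; rw [← mul_assoc (v q j), ← h, mul_assoc]
    have e2 : u i p * v p k * (u i q * v q j) = (u i p * u i q) * (v p k * v q j) := by
      simp only [mul_assoc]; rw [← mul_assoc (v p k), ← h, mul_assoc]
    rw [e1, e2]
    by_cases hpq : p = q
    · subst hpq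
      rw [hv.anticomm_row p j k hjk, mul_neg]
    · rw [hu.anticomm_row i q p hpq, hv.comm q j p k (Ne.symm hpq) hjk.symm, neg_mul]
  anticomm_col i j k hik := by
    simp only [Matrix.mul_apply, Finset.sum_mul_sum]
    rw [Finset.sum_comm, ← Finset.sum_neg_distrib]
    refine Finset.sum_congr rfl fun p _ => ?_
    rw [← Finset.sum_neg_distrib]
    refine Finset.sum_congr rfl fun q _ => ?_
    have e1 : u i q * v q j * (u k p * v p j) = (u i q * u k p) * (v q j * v p j) := by
      simp only [mul_assoc]; rw [← mul_assoc (v q j), ← h, mul_assoc]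
    have e2 : u k p * v p j * (u i q * v q j) = (u k p * u i q) * (v p j * v q j) := by
      simp only [mul_assoc]; rw [← mul_assoc (v p j), ← h, mul_assoc]
    rw [e1, e2]
    by_cases hpq : p = q
    · subst hpq
      rw [hu.anticomm_col i p k hik, neg_mul]
    · rw [hv.anticomm_col q j p hpq, hu.comm i q k p hik.symm (Ne.symm hpq), mul_neg]
  comm i j k l hik hjl := by
    simp only [Matrix.mul_apply, Finset.sum_mul_sum]
    rw [Finset.sum_comm]
    refine Finset.sum_congr rfl fun p _ => ?_
    refine Finset.sum_congr rfl fun q _ => ?_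
    have e1 : u i q * v q j * (u k p * v p l) = (u i q * u k p) * (v q j * v p l) := by
      simp only [mul_assoc]; rw [← mul_assoc (v q j), ← h, mul_assoc]
    have e2 : u k p * v p l * (u i q * v q j) = (u k p * u i q) * (v p l * v q j) := by
      simp only [mul_assoc]; rw [← mul_assoc (v p l), ← h, mul_assoc]
    rw [e1, e2]
    by_cases hpq : p = q
    · subst hpq
      rw [hu.anticomm_col i p k hik.symm, hv.anticomm_row p j l hjl.symm, neg_mul_neg]
    · rw [hv.comm q j p l (Ne.symm hpq) hjl, hu.comm i q k p hik (Ne.symm hpq)]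
  perm_eq_one := by
    have key : ∀ a b c, (u * v) 0 a * (u * v) 1 b * (u * v) 2 c =
        ∑ r, ∑ q, ∑ p, (u 0 p * u 1 q * u 2 r) * (v p a * v q b * v r c) := by
      intro a b c
      simp only [Matrix.mul_apply, Finset.sum_mul, Finset.mul_sum]
      refine Finset.sum_congr rfl fun r _ => Finset.sum_congr rfl fun q _ =>
        Finset.sum_congr rfl fun p _ => ?_
      calc u 0 p * v p a * (u 1 q * v q b) * (u 2 r * v r c)
          = u 0 p * (v p a * u 1 q) * (v q b * u 2 r) * v r c := by noncomm_ring
        _ = u 0 p * (u 1 q * v p a) * (u 2 r * v q b) * v r c := by rw [← h, ← h]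
        _ = u 0 p * u 1 q * (v p a * u 2 r) * v q b * v r c := by noncomm_ring
        _ = _ := by rw [← h]; noncomm_ring
    have e : ∑ σ : Equiv.Perm (Fin 3), (u * v) 0 (σ 0) * (u * v) 1 (σ 1) * (u * v) 2 (σ 2) =
        ∑ r, ∑ q, ∑ p, (u 0 p * u 1 q * u 2 r) *
          ∑ σ : Equiv.Perm (Fin 3), v p (σ 0) * v q (σ 1) * v r (σ 2) := by
      simp only [key, Finset.mul_sum]
      rw [Finset.sum_comm]
      refine Finset.sum_congr rfl fun p _ => ?_
      rw [Finset.sum_comm]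
      refine Finset.sum_congr rfl fun q _ => ?_
      rw [Finset.sum_comm]
    rw [e]
    simp only [hv.perm_rows]
    have h1 := hu.perm_eq_one
    rw [sum_perm fun a b c => u 0 a * u 1 b * u 2 c] at h1
    simp [Fin.sum_univ_three]
    rw [← h1]
    abel

end SOm3Relations

/-- The relations of `SO_{-1}(3)` imposed on the free algebra on the letters `a i j`. -/
inductive SOm3Rel : FreeAlgebra ℂ (Fin 3 × Fin 3) → FreeAlgebra ℂ (Fin 3 × Fin 3) → Prop
  | mul_transpose (i j : Fin 3) :
      SOm3Rel (∑ k, FreeAlgebra.ι ℂ (i, k) * FreeAlgebra.ι ℂ (j, k)) (if i = j then 1 else 0)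
  | transpose_mul (i j : Fin 3) :
      SOm3Rel (∑ k, FreeAlgebra.ι ℂ (k, i) * FreeAlgebra.ι ℂ (k, j)) (if i = j then 1 else 0)
  | anticomm_row (i j k : Fin 3) : k ≠ j →
      SOm3Rel (FreeAlgebra.ι ℂ (i, j) * FreeAlgebra.ι ℂ (i, k))
        (-(FreeAlgebra.ι ℂ (i, k) * FreeAlgebra.ι ℂ (i, j)))
  | anticomm_col (i j k : Fin 3) : k ≠ i →
      SOm3Rel (FreeAlgebra.ι ℂ (i, j) * FreeAlgebra.ι ℂ (k, j))
        (-(FreeAlgebra.ι ℂ (k, j) * FreeAlgebra.ι ℂ (i, j)))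
  | comm (i j k l : Fin 3) : i ≠ k → j ≠ l →
      SOm3Rel (FreeAlgebra.ι ℂ (i, j) * FreeAlgebra.ι ℂ (k, l))
        (FreeAlgebra.ι ℂ (k, l) * FreeAlgebra.ι ℂ (i, j))
  | perm_eq_one :
      SOm3Rel (∑ σ : Equiv.Perm (Fin 3), FreeAlgebra.ι ℂ (0, σ 0) * FreeAlgebra.ι ℂ (1, σ 1) *
        FreeAlgebra.ι ℂ (2, σ 2)) 1

/-- The algebra `Pol(SO_{-1}(3))`: the universal complex unital algebra generated by the entries
of a `3 × 3` matrix satisfying the relations of `SO_{-1}(3)`. Together with the involution below,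
which fixes the generators, it is the universal unital `*`-algebra generated by self-adjoint
elements satisfying these relations. -/
def PolSOm3 : Type := RingQuot SOm3Rel

namespace PolSOm3

noncomputable instance : Ring PolSOm3 := inferInstanceAs (Ring (RingQuot SOm3Rel))

noncomputable instance : Algebra ℂ PolSOm3 := inferInstanceAs (Algebra ℂ (RingQuot SOm3Rel))

/-- The quotient map from the free algebra. -/
noncomputable def mk : FreeAlgebra ℂ (Fin 3 × Fin 3) →ₐ[ℂ] PolSOm3 := RingQuot.mkAlgHom ℂ SOm3Rel

/-- The matrix `A = (a i j)` of generators. -/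
noncomputable def gen : Matrix (Fin 3) (Fin 3) PolSOm3 :=
  Matrix.of fun i j => mk (FreeAlgebra.ι ℂ (i, j))

theorem mk_surjective : Function.Surjective mk := RingQuot.mkAlgHom_surjective ℂ SOm3Rel

theorem mk_rel {x y} (h : SOm3Rel x y) : mk x = mk y := RingQuot.mkAlgHom_rel ℂ h

theorem relations_gen : SOm3Relations gen where
  mul_transpose := by
    ext i j
    have := mk_rel (.mul_transpose i j)
    simpa [Matrix.mul_apply, gen, Matrix.one_apply, apply_ite mk] using this
  transpose_mul := by
    ext i j
    have := mk_rel (.transpose_mul i j)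
    simpa [Matrix.mul_apply, gen, Matrix.one_apply, apply_ite mk] using this
  anticomm_row i j k h := by simpa [gen] using mk_rel (.anticomm_row i j k h)
  anticomm_col i j k h := by simpa [gen] using mk_rel (.anticomm_col i j k h)
  comm i j k l h h' := by simpa [gen] using mk_rel (.comm i j k l h h')
  perm_eq_one := by simpa [gen] using mk_rel .perm_eq_one

section lift

variable {B : Type*} [Ring B] [Algebra ℂ B]

theorem freeLift_rel (u : Matrix (Fin 3) (Fin 3) B) (hu : SOm3Relations u) ⦃x y⦄
    (h : SOm3Rel x y) : FreeAlgebra.lift ℂ (fun p : Fin 3 × Fin 3 => u p.1 p.2) x =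
      FreeAlgebra.lift ℂ (fun p : Fin 3 × Fin 3 => u p.1 p.2) y := by
  induction h with
  | mul_transpose i j =>
    have := congrFun (congrFun hu.mul_transpose i) j
    rw [apply_ite (FreeAlgebra.lift ℂ fun p : Fin 3 × Fin 3 => u p.1 p.2)]
    simpa [Matrix.mul_apply, Matrix.one_apply] using this
  | transpose_mul i j =>
    have := congrFun (congrFun hu.transpose_mul i) j
    rw [apply_ite (FreeAlgebra.lift ℂ fun p : Fin 3 × Fin 3 => u p.1 p.2)]
    simpa [Matrix.mul_apply, Matrix.one_apply] using this
  | anticomm_row i j k h => simpa using hu.anticomm_row i j k h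
  | anticomm_col i j k h => simpa using hu.anticomm_col i j k h
  | comm i j k l h h' => simpa using hu.comm i j k l h h'
  | perm_eq_one => simpa using hu.perm_eq_one

/-- The universal property of `Pol(SO_{-1}(3))`. -/
noncomputable def lift (u : Matrix (Fin 3) (Fin 3) B) (hu : SOm3Relations u) :
    PolSOm3 →ₐ[ℂ] B :=
  RingQuot.liftAlgHom ℂ ⟨FreeAlgebra.lift ℂ fun p => u p.1 p.2, freeLift_rel u hu⟩

@[simp]
theorem lift_gen (u : Matrix (Fin 3) (Fin 3) B) (hu : SOm3Relations u) (i j : Fin 3) :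
    lift u hu (gen i j) = u i j := by
  have := RingQuot.liftAlgHom_mkAlgHom_apply (S := ℂ) (s := SOm3Rel)
    (FreeAlgebra.lift ℂ fun p => u p.1 p.2) (freeLift_rel u hu) (FreeAlgebra.ι ℂ (i, j))
  rw [FreeAlgebra.lift_ι_apply] at this
  exact this

@[ext]
theorem algHom_ext {f g : PolSOm3 →ₐ[ℂ] B} (h : ∀ i j, f (gen i j) = g (gen i j)) : f = g := by
  have : f.comp mk = g.comp mk := by
    apply FreeAlgebra.hom_ext
    funext p
    exact h p.1 p.2
  ext x
  obtain ⟨x, rfl⟩ := mk_surjective x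
  exact DFunLike.congr_fun this x

end lift

theorem induction {p : PolSOm3 → Prop} (hs : ∀ r : ℂ, p (algebraMap ℂ PolSOm3 r))
    (hg : ∀ i j, p (gen i j)) (hm : ∀ x y, p x → p y → p (x * y))
    (ha : ∀ x y, p x → p y → p (x + y)) (x : PolSOm3) : p x := by
  obtain ⟨x, rfl⟩ := mk_surjective x
  induction x using FreeAlgebra.induction with
  | grade0 r => simpa using hs r
  | grade1 q => exact hg q.1 q.2
  | mul x y hx hy => simpa using hm _ _ hx hy
  | add x y hx hy => simpa using ha _ _ hx hy

/-! The involution: the conjugate-linear antimultiplicative map fixing the generators. -/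

/-- The opposite of a complex algebra, with the conjugate scalar action. -/
def ConjOp (A : Type*) : Type _ := Aᵐᵒᵖ

noncomputable instance (A : Type*) [Ring A] : Ring (ConjOp A) := inferInstanceAs (Ring Aᵐᵒᵖ)

noncomputable instance (A : Type*) [Ring A] [Algebra ℂ A] : Algebra ℂ (ConjOp A) :=
  RingHom.toAlgebra' ((algebraMap ℂ Aᵐᵒᵖ).comp (starRingEnd ℂ))
    fun c x => Algebra.commutes (A := Aᵐᵒᵖ) (starRingEnd ℂ c) x

theorem relations_star :
    SOm3Relations (B := ConjOp PolSOm3) (Matrix.of fun i j => MulOpposite.op (gen i j)) := by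
  exact relations_gen.op

/-- The involution, as an algebra homomorphism to the conjugate opposite algebra. -/
noncomputable def starHom : PolSOm3 →ₐ[ℂ] ConjOp PolSOm3 := lift _ relations_star

/-- The involution as a function. -/
noncomputable def starFun (x : PolSOm3) : PolSOm3 := MulOpposite.unop (starHom x)

theorem starFun_gen (i j : Fin 3) : starFun (gen i j) = gen i j := by
  simp only [starFun, starHom, lift_gen]
  rfl

theorem starFun_add (x y : PolSOm3) : starFun (x + y) = starFun x + starFun y := by
  simp only [starFun, map_add]
  rfl

theorem starFun_mul (x y : PolSOm3) : starFun (x * y) = starFun y * starFun x := by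
  simp only [starFun, map_mul]
  rfl

theorem starFun_algebraMap (r : ℂ) :
    starFun (algebraMap ℂ PolSOm3 r) = algebraMap ℂ PolSOm3 (star r) := by
  simp only [starFun, AlgHom.commutes]
  rfl

noncomputable instance : StarRing PolSOm3 where
  star := starFun
  star_involutive x := by
    induction x using induction with
    | hs r => rw [starFun_algebraMap, starFun_algebraMap, star_star]
    | hg i j => rw [starFun_gen, starFun_gen]
    | hm x y hx hy => rw [starFun_mul, starFun_mul, hx, hy]
    | ha x y hx hy => rw [starFun_add, starFun_add, hx, hy]
  star_mul := starFun_mul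
  star_add := starFun_add

@[simp]
theorem star_gen (i j : Fin 3) : star (gen i j) = gen i j := starFun_gen i j

theorem star_algebraMap (r : ℂ) :
    star (algebraMap ℂ PolSOm3 r) = algebraMap ℂ PolSOm3 (star r) := starFun_algebraMap r

instance : StarModule ℂ PolSOm3 where
  star_smul r x := by
    rw [Algebra.smul_def, star_mul, star_algebraMap, Algebra.smul_def, Algebra.commutes]

/-! The Hopf algebra structure: `Δ(a i j) = ∑ k, a i k ⊗ a k j`, `ε(a i j) = δ i j` and
`S(a i j) = a j i`. -/

/-- The matrix `(∑ k, a i k ⊗ a k j)`. -/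
noncomputable def comulMatrix : Matrix (Fin 3) (Fin 3) (PolSOm3 ⊗[ℂ] PolSOm3) :=
  Matrix.of fun i j => ∑ k, gen i k ⊗ₜ[ℂ] gen k j

theorem relations_comul : SOm3Relations comulMatrix := by
  have h := (relations_gen.map
    (Algebra.TensorProduct.includeLeft : PolSOm3 →ₐ[ℂ] PolSOm3 ⊗[ℂ] PolSOm3).toRingHom).mul
    (relations_gen.map
    (Algebra.TensorProduct.includeRight : PolSOm3 →ₐ[ℂ] PolSOm3 ⊗[ℂ] PolSOm3).toRingHom)
    (by intro i j k l; simp)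
  convert h using 1
  ext i j
  simp [comulMatrix, Matrix.mul_apply]

/-- The comultiplication. -/
noncomputable def comulHom : PolSOm3 →ₐ[ℂ] PolSOm3 ⊗[ℂ] PolSOm3 :=
  lift comulMatrix relations_comul

/-- The counit. -/
noncomputable def counitHom : PolSOm3 →ₐ[ℂ] ℂ := lift 1 SOm3Relations.one

/-- The antipode, as an algebra homomorphism to the opposite algebra. -/
noncomputable def antipodeHom : PolSOm3 →ₐ[ℂ] PolSOm3ᵐᵒᵖ :=
  lift (genᵀ.map MulOpposite.op) relations_gen.transpose.op

@[simp]
theorem comulHom_gen (i j : Fin 3) : comulHom (gen i j) = ∑ k, gen i k ⊗ₜ[ℂ] gen k j := by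
  simp [comulHom, comulMatrix]

@[simp]
theorem counitHom_gen (i j : Fin 3) : counitHom (gen i j) = if i = j then 1 else 0 := by
  simp [counitHom, Matrix.one_apply]

noncomputable instance : Bialgebra ℂ PolSOm3 :=
  Bialgebra.ofAlgHom comulHom counitHom
    (by
      ext i j
      simp only [AlgHom.comp_apply, comulHom_gen, map_sum, Algebra.TensorProduct.map_tmul,
        TensorProduct.sum_tmul, TensorProduct.tmul_sum, AlgHom.id_apply]
      rw [Finset.sum_comm]
      simp)
    (by
      ext i j
      simp [TensorProduct.ite_tmul])
    (by
      ext i j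
      simp [TensorProduct.tmul_ite])

/-- The antipode. -/
noncomputable def antipodeMap : PolSOm3 →ₗ[ℂ] PolSOm3 :=
  (MulOpposite.opLinearEquiv ℂ).symm.toLinearMap ∘ₗ antipodeHom.toLinearMap

@[simp]
theorem antipodeMap_gen (i j : Fin 3) : antipodeMap (gen i j) = gen j i := by
  simp [antipodeMap, antipodeHom]

theorem antipodeMap_mul (x y : PolSOm3) :
    antipodeMap (x * y) = antipodeMap y * antipodeMap x := by
  simp [antipodeMap]

theorem antipodeMap_algebraMap (r : ℂ) :
    antipodeMap (algebraMap ℂ PolSOm3 r) = algebraMap ℂ PolSOm3 r := by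
  simp [antipodeMap]

theorem antipode_rTensor_mul (t s : PolSOm3 ⊗[ℂ] PolSOm3) (r : ℂ)
    (ht : LinearMap.mul' ℂ PolSOm3 (antipodeMap.rTensor PolSOm3 t) = algebraMap ℂ PolSOm3 r) :
    LinearMap.mul' ℂ PolSOm3 (antipodeMap.rTensor PolSOm3 (t * s)) =
      r • LinearMap.mul' ℂ PolSOm3 (antipodeMap.rTensor PolSOm3 s) := by
  induction s using TensorProduct.induction_on with
  | zero => simp
  | add s s' hs hs' => rw [mul_add, map_add, map_add, hs, hs', map_add, map_add, smul_add]
  | tmul c d =>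
    have key : LinearMap.mul' ℂ PolSOm3 (antipodeMap.rTensor PolSOm3 (t * c ⊗ₜ d)) =
        antipodeMap c * LinearMap.mul' ℂ PolSOm3 (antipodeMap.rTensor PolSOm3 t) * d := by
      clear ht
      induction t using TensorProduct.induction_on with
      | zero => simp
      | add t t' h h' => rw [add_mul, map_add, map_add, h, h', map_add, map_add, mul_add, add_mul]
      | tmul a b => simp [antipodeMap_mul, mul_assoc]
    rw [key, ht, ← Algebra.commutes, mul_assoc, ← Algebra.smul_def]
    simp

theorem antipode_lTensor_mul (t s : PolSOm3 ⊗[ℂ] PolSOm3) (r : ℂ)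
    (hs : LinearMap.mul' ℂ PolSOm3 (antipodeMap.lTensor PolSOm3 s) = algebraMap ℂ PolSOm3 r) :
    LinearMap.mul' ℂ PolSOm3 (antipodeMap.lTensor PolSOm3 (t * s)) =
      r • LinearMap.mul' ℂ PolSOm3 (antipodeMap.lTensor PolSOm3 t) := by
  induction t using TensorProduct.induction_on with
  | zero => simp
  | add s s' hs hs' => rw [add_mul, map_add, map_add, hs, hs', map_add, map_add, smul_add]
  | tmul c d =>
    have key : LinearMap.mul' ℂ PolSOm3 (antipodeMap.lTensor PolSOm3 (c ⊗ₜ d * s)) =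
        c * LinearMap.mul' ℂ PolSOm3 (antipodeMap.lTensor PolSOm3 s) * antipodeMap d := by
      clear hs
      induction s using TensorProduct.induction_on with
      | zero => simp
      | add t t' h h' => rw [mul_add, map_add, map_add, h, h', map_add, map_add, mul_add, add_mul]
      | tmul a b => simp [antipodeMap_mul, mul_assoc]
    rw [key, hs, ← Algebra.commutes, mul_assoc, ← Algebra.smul_def]
    simp

theorem comul_eq (x : PolSOm3) : Coalgebra.comul (R := ℂ) x = comulHom x := rfl

theorem counit_eq (x : PolSOm3) : Coalgebra.counit (R := ℂ) x = counitHom x := rfl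

noncomputable instance : HopfAlgebra ℂ PolSOm3 where
  antipode := antipodeMap
  mul_antipode_rTensor_comul := by
    ext x
    simp only [LinearMap.comp_apply, comul_eq, counit_eq, Algebra.linearMap_apply]
    induction x using induction with
    | hs r => simp [Algebra.TensorProduct.algebraMap_apply, antipodeMap_algebraMap]
    | hg i j =>
      have := congrFun (congrFun relations_gen.transpose_mul i) j
      simpa [Matrix.mul_apply, Matrix.one_apply, apply_ite (algebraMap ℂ PolSOm3)] using this
    | hm x y hx hy =>
      rw [map_mul, antipode_rTensor_mul _ _ _ hx, hy, map_mul, map_mul, Algebra.smul_def]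
    | ha x y hx hy => rw [map_add, map_add, map_add, hx, hy, map_add, map_add]
  mul_antipode_lTensor_comul := by
    ext x
    simp only [LinearMap.comp_apply, comul_eq, counit_eq, Algebra.linearMap_apply]
    induction x using induction with
    | hs r =>
      have h1 : antipodeMap 1 = 1 := by simpa using antipodeMap_algebraMap 1
      simp [Algebra.TensorProduct.algebraMap_apply, h1]
    | hg i j =>
      have := congrFun (congrFun relations_gen.mul_transpose i) j
      simpa [Matrix.mul_apply, Matrix.one_apply, apply_ite (algebraMap ℂ PolSOm3)] using this
    | hm x y hx hy =>
      rw [map_mul, antipode_lTensor_mul _ _ _ hy, hx, map_mul, mul_comm, map_mul, Algebra.smul_def]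
    | ha x y hx hy => rw [map_add, map_add, map_add, hx, hy, map_add, map_add]

/-- The comultiplication is a `*`-homomorphism, so `Pol(SO_{-1}(3))` is a Hopf `*`-algebra. -/
theorem comul_star (x : PolSOm3) :
    Coalgebra.comul (R := ℂ) (star x) = star (Coalgebra.comul (R := ℂ) x) := by
  simp only [comul_eq]
  induction x using induction with
  | hs r =>
    rw [star_algebraMap, AlgHom.commutes, AlgHom.commutes,
      Algebra.TensorProduct.algebraMap_apply, Algebra.TensorProduct.algebraMap_apply,
      TensorProduct.star_tmul, star_algebraMap, star_one]
  | hg i j => simp [star_sum]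
  | hm x y hx hy => rw [star_mul, map_mul, map_mul, star_mul, hx, hy]
  | ha x y hx hy => rw [star_add, map_add, map_add, star_add, hx, hy]

end PolSOm3

/-- The group of Hopf `*`-automorphisms of a Hopf `*`-algebra: the algebra automorphisms
compatible with the comultiplication, the counit and the involution. -/
def hopfStarAut (A : Type*) [Ring A] [HopfAlgebra ℂ A] [StarRing A] :
    Subgroup (A ≃ₐ[ℂ] A) where
  carrier := {θ |
    (∀ x, Coalgebra.comul (R := ℂ) (θ x) =
      TensorProduct.map θ.toLinearMap θ.toLinearMap (Coalgebra.comul (R := ℂ) x)) ∧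
    (∀ x, Coalgebra.counit (R := ℂ) (θ x) = Coalgebra.counit (R := ℂ) x) ∧
    ∀ x, θ (star x) = star (θ x)}
  one_mem' := by
    refine ⟨fun x => ?_, fun x => rfl, fun x => rfl⟩
    exact (LinearMap.congr_fun (TensorProduct.map_id (R := ℂ) (M := A) (N := A)) _).symm
  mul_mem' := by
    rintro θ η ⟨h1, h2, h3⟩ ⟨k1, k2, k3⟩
    refine ⟨fun x => ?_, fun x => ?_, fun x => ?_⟩
    · rw [AlgEquiv.mul_apply, h1, k1, ← LinearMap.comp_apply, ← TensorProduct.map_comp]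
      rfl
    · rw [AlgEquiv.mul_apply, h2, k2]
    · rw [AlgEquiv.mul_apply, k3, h3, AlgEquiv.mul_apply]
  inv_mem' := by
    rintro θ ⟨h1, h2, h3⟩
    have e : ∀ x, θ (θ⁻¹ x) = x := θ.apply_symm_apply
    have e' : ∀ x, θ⁻¹ (θ x) = x := θ.symm_apply_apply
    refine ⟨fun x => ?_, fun x => ?_, fun x => ?_⟩
    · have h := congrArg (TensorProduct.map (θ⁻¹).toLinearMap (θ⁻¹).toLinearMap) (h1 (θ⁻¹ x))
      rw [e, ← LinearMap.comp_apply (TensorProduct.map (θ⁻¹).toLinearMap (θ⁻¹).toLinearMap)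
        (TensorProduct.map θ.toLinearMap θ.toLinearMap), ← TensorProduct.map_comp] at h
      have i : (θ⁻¹).toLinearMap ∘ₗ θ.toLinearMap = LinearMap.id := LinearMap.ext e'
      rw [i, TensorProduct.map_id] at h
      exact h.symm
    · rw [← h2, e]
    · apply θ.injective
      rw [h3, e, e]

/-! The standard representation of `S_4`. -/

/-- The orthonormal basis `(1,1,-1,-1)/2`, `(1,-1,1,-1)/2`, `(1,-1,-1,1)/2` of the orthogonal
complement of `(1,1,1,1)` in `ℝ⁴`, consisting of joint eigenvectors of the normal Klein subgroup
of `S_4`. -/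
noncomputable def stdBasis : Matrix (Fin 3) (Fin 4) ℝ :=
  !![1/2, 1/2, -1/2, -1/2; 1/2, -1/2, 1/2, -1/2; 1/2, -1/2, -1/2, 1/2]

/-- The matrix coefficient `⟨f i, x • f j⟩`, where `f` is the basis `stdBasis` and `x • e k = e (x k)`
is the permutation action on `ℝ⁴`. -/
noncomputable def stdRepMatrix (x : Equiv.Perm (Fin 4)) : Matrix (Fin 3) (Fin 3) ℝ :=
  Matrix.of fun i j => ∑ k, stdBasis i (x k) * stdBasis j k

theorem stdBasis_mul_transpose : stdBasis * stdBasisᵀ = 1 := by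
  ext i j
  fin_cases i <;> fin_cases j <;>
    simp [stdBasis, Matrix.mul_apply, Fin.sum_univ_four] <;> norm_num

theorem stdBasis_transpose_mul (k l : Fin 4) :
    ∑ i, stdBasis i k * stdBasis i l = (if k = l then 1 else 0) - 1 / 4 := by
  fin_cases k <;> fin_cases l <;>
    simp [stdBasis, Fin.sum_univ_three] <;> norm_num

theorem stdBasis_sum (i : Fin 3) : ∑ k, stdBasis i k = 0 := by
  fin_cases i <;> simp [stdBasis, Fin.sum_univ_four] <;> norm_num

theorem stdRepMatrix_one : stdRepMatrix 1 = 1 := by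
  rw [← stdBasis_mul_transpose]
  ext i j
  simp [stdRepMatrix, Matrix.mul_apply]

theorem stdRepMatrix_mul (x y : Equiv.Perm (Fin 4)) :
    stdRepMatrix (x * y) = stdRepMatrix x * stdRepMatrix y := by
  ext i j
  simp only [stdRepMatrix, Matrix.mul_apply, Matrix.of_apply, Finset.sum_mul_sum]
  have h : ∀ m k l, stdBasis i (x k) * stdBasis m k * (stdBasis m (y l) * stdBasis j l) =
      stdBasis i (x k) * stdBasis j l * (stdBasis m k * stdBasis m (y l)) := by
    intros; ring
  simp only [h]
  rw [Finset.sum_comm]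
  simp only [Finset.sum_comm (s := (Finset.univ : Finset (Fin 3))), ← Finset.mul_sum,
    stdBasis_transpose_mul, mul_sub, Finset.sum_sub_distrib]
  have h0 : ∑ k, ∑ l, stdBasis i (x k) * stdBasis j l * (1 / 4) = 0 := by
    simp [← Finset.sum_mul, ← Finset.mul_sum, stdBasis_sum]
  rw [h0, sub_zero, Finset.sum_comm]
  simp

theorem stdRepMatrix_inv (x : Equiv.Perm (Fin 4)) : stdRepMatrix x⁻¹ = (stdRepMatrix x)ᵀ := by
  ext i j
  simp only [stdRepMatrix, Matrix.of_apply, Matrix.transpose_apply]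
  rw [← Equiv.sum_comp x]
  simp [mul_comm]

/-- The standard representation `ρ : S_4 → O(3)`: the permutation representation on the orthogonal
complement of `(1,1,1,1)`, in the orthonormal basis `stdBasis`. -/
noncomputable def stdRep : Equiv.Perm (Fin 4) →* Matrix.orthogonalGroup (Fin 3) ℝ where
  toFun x := ⟨stdRepMatrix x, by
    rw [Matrix.mem_orthogonalGroup_iff, ← stdRepMatrix_inv, ← stdRepMatrix_mul, mul_inv_cancel,
      stdRepMatrix_one]⟩
  map_one' := Subtype.ext stdRepMatrix_one
  map_mul' x y := Subtype.ext (stdRepMatrix_mul x y)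

/-- A real matrix, viewed as a matrix of scalars in `Pol(SO_{-1}(3))`. -/
noncomputable def PolSOm3.scalarMatrix (F : Matrix (Fin 3) (Fin 3) ℝ) :
    Matrix (Fin 3) (Fin 3) PolSOm3 :=
  F.map fun t => algebraMap ℂ PolSOm3 (t : ℂ)

/-! An automorphism θ permutes the characters of the algebra. In a commutative domain the relations
leave only signed permutation matrices whose signs have product 1, and these are exactly the ρ(x)
with x in S_4 (`exists_permChar_eq`). Convolution of characters is the group law of S_4, so θ
induces an automorphism of S_4, which is inner (`perm_hom_eq_conj`). Composing θ with a conjugation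
by some ρ(z) therefore gives an automorphism fixing every character, and the main point is that such
an automorphism is the identity (`eq_one_of_fixes_characters`).

The Lie algebra so(3) is replaced by three functionals X_k (`skewFun`) with X_k(xy) = ε(x) X_k(y) +
X_k(x) χ_k(y), where χ_k is a diagonal character. An automorphism θ fixing all characters commutes
with translations by characters, hence with all conjugations by ρ(x). By this symmetry X_k ∘ θ = α
X_k with the same scalar α for all k. The associated skew derivations satisfy D_i D_j + D_j D_i =
D_k (`skewDer_anticommutator`), so α² = α; bijectivity excludes α = 0. Thus θ commutes with every
D_k and preserves ε and χ_k. The range of θ - id is then stable under the D_k and killed by ε and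
χ_k, and a Taylor expansion along one-parameter groups shows that it is zero
(`eq_zero_of_mem_of_skewDer_mem`).

That expansion takes place on the classical group. Tensoring a_ij with the quaternionic map q ↦ -e_i
q e_j exchanges the relations of `SO_{-1}(3)` with those of SO(3), and doing so twice recovers a_ij,
so the algebra embeds in 4 × 4 matrices over a commutative ring generated by a special orthogonal
matrix. Writing rotations through unit quaternions turns elements into homogeneous polynomials, so
real rotations already separate points (`eq_zero_of_twistRep_quatRotation`). -/

/-! ### Finite facts about S_4 and signed permutation matrices. -/

/-- Twice the matrix `stdBasis`, with integer entries. -/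
def intBasis : Matrix (Fin 3) (Fin 4) ℤ := !![1, 1, -1, -1; 1, -1, 1, -1; 1, -1, -1, 1]

theorem stdRepMatrix_apply (x : Equiv.Perm (Fin 4)) (i j : Fin 3) :
    4 * stdRepMatrix x i j = ((∑ k, intBasis i (x k) * intBasis j k : ℤ) : ℝ) := by
  have h : ∀ i k, stdBasis i k = (intBasis i k : ℝ) / 2 := by
    intro i k
    fin_cases i <;> fin_cases k <;> simp [stdBasis, intBasis]
  simp only [stdRepMatrix, Matrix.of_apply, h, Finset.mul_sum, Int.cast_sum, Int.cast_mul]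
  exact Finset.sum_congr rfl fun k _ => by ring

-- The basis vectors span the joint eigenlines of the normal Klein subgroup, so S_4 permutes these
-- lines. The product of the signs is the permanent of the signed permutation matrix, which matches
-- the last defining relation.
set_option maxRecDepth 100000 in
theorem intBasis_signedPerm : ∀ x : Equiv.Perm (Fin 4), ∃ p : Equiv.Perm (Fin 3), ∃ e : Fin 3 → ℤˣ,
    e 0 * e 1 * e 2 = 1 ∧
    ∀ i j, ∑ k, intBasis i (x k) * intBasis j k = 4 * if i = p j then (e j : ℤ) else 0 := by
  decide

-- There are 6 · 4 = 24 such pairs, as many as elements of S_4, and ρ is faithful.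
set_option maxRecDepth 100000 in
theorem exists_intBasis_signedPerm : ∀ p : Equiv.Perm (Fin 3), ∀ e : Fin 3 → ℤˣ,
    e 0 * e 1 * e 2 = 1 → ∃ x : Equiv.Perm (Fin 4),
    ∀ i j, ∑ k, intBasis i (x k) * intBasis j k = 4 * if i = p j then (e j : ℤ) else 0 := by
  decide

set_option maxRecDepth 100000 in
theorem intBasis_faithful : ∀ x : Equiv.Perm (Fin 4),
    (∀ i j, ∑ k, intBasis i (x k) * intBasis j k = 4 * if i = j then 1 else 0) → x = 1 := by
  decide

-- This is the finite core of the fact that automorphisms of S_4 are inner. Here `c` is a 4-cycle,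
-- hence odd; `s * c` must be even, so `s` is a transposition, and the condition on its cube forces
-- `s` to exchange two neighbours in the cycle. All such pairs are conjugate.
set_option maxRecDepth 100000 in
set_option synthInstance.maxHeartbeats 400000 in
set_option synthInstance.maxSize 1000 in
theorem exists_conj_finRotate_swap : ∀ c s : Equiv.Perm (Fin 4),
    (c ^ 4 = 1 ∧ c ^ 2 ≠ 1) ∧ (s ^ 2 = 1 ∧ s ≠ 1) ∧ (s * c) ^ 3 = 1 →
    ∃ z : Equiv.Perm (Fin 4), z * finRotate 4 = c * z ∧ z * Equiv.swap 0 1 = s * z := by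
  decide

/-! ### The quaternionic twist between `SO_{-1}(3)` and SO(3). -/

/-- The matrix of the map `q ↦ -e_i q e_j` of the quaternions, in the basis `1, e_0, e_1, e_2`. -/
def quatMat : Fin 3 → Fin 3 → Matrix (Fin 4) (Fin 4) ℤ :=
  ![![!![1, 0, 0, 0; 0, 1, 0, 0; 0, 0, -1, 0; 0, 0, 0, -1],
      !![0, 0, 0, -1; 0, 0, 1, 0; 0, 1, 0, 0; -1, 0, 0, 0],
      !![0, 0, 1, 0; 0, 0, 0, 1; 1, 0, 0, 0; 0, 1, 0, 0]],
    ![!![0, 0, 0, 1; 0, 0, 1, 0; 0, 1, 0, 0; 1, 0, 0, 0],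
      !![1, 0, 0, 0; 0, -1, 0, 0; 0, 0, 1, 0; 0, 0, 0, -1],
      !![0, -1, 0, 0; -1, 0, 0, 0; 0, 0, 0, 1; 0, 0, 1, 0]],
    ![!![0, 0, -1, 0; 0, 0, 0, 1; -1, 0, 0, 0; 0, 1, 0, 0],
      !![0, 1, 0, 0; 1, 0, 0, 0; 0, 0, 0, 1; 0, 0, 1, 0],
      !![1, 0, 0, 0; 0, -1, 0, 0; 0, 0, -1, 0; 0, 0, 0, 1]]]

/-- The matrix of the map `q ↦ q e_k` of the quaternions. -/
def quatRight : Fin 3 → Matrix (Fin 4) (Fin 4) ℤ :=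
  ![!![0, -1, 0, 0; 1, 0, 0, 0; 0, 0, 0, 1; 0, 0, -1, 0],
    !![0, 0, -1, 0; 0, 0, 0, -1; 1, 0, 0, 0; 0, 1, 0, 0],
    !![0, 0, 0, -1; 0, 0, 1, 0; 0, -1, 0, 0; 1, 0, 0, 0]]

/-- Left and right multiplications commute and distinct units anticommute, so each index in which
two of these maps differ contributes one sign: one differing index gives anticommutation, two give
commutation. -/
theorem quatMat_row : ∀ i j k, k ≠ j →
    quatMat i j * quatMat i k = -(quatMat i k * quatMat i j) := by decide

theorem quatMat_col : ∀ i j k, k ≠ i →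
    quatMat i j * quatMat k j = -(quatMat k j * quatMat i j) := by decide

theorem quatMat_comm : ∀ i j k l, i ≠ k → j ≠ l →
    quatMat i j * quatMat k l = quatMat k l * quatMat i j := by decide

/-- The product is q ↦ -e_i e_j q whatever `k` is, so the quaternionic factor comes out of the sums
in the orthogonality relations. -/
theorem quatMat_row_row : ∀ i j k, quatMat i k * quatMat j k = quatMat i 0 * quatMat j 0 := by
  decide

theorem quatMat_col_col : ∀ i j k, quatMat k i * quatMat k j = quatMat 0 i * quatMat 0 j := by
  decide

theorem quatMat_sq : ∀ i j, quatMat i j * quatMat i j = 1 := by decide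

theorem quatMat_transpose : ∀ i j, (quatMat i j)ᵀ = quatMat i j := by decide

/-- The Kronecker product of an integer matrix with an element of a ring. -/
def intKron {B : Type*} [Ring B] (Z : Matrix (Fin 4) (Fin 4) ℤ) (b : B) :
    Matrix (Fin 4) (Fin 4) B := Matrix.of fun c d => (Z c d : B) * b

section intKron

variable {B : Type*} [Ring B]

theorem intKron_apply (Z : Matrix (Fin 4) (Fin 4) ℤ) (b : B) (c d : Fin 4) :
    intKron Z b c d = (Z c d : B) * b := rfl

theorem intKron_mul (Z W : Matrix (Fin 4) (Fin 4) ℤ) (a b : B) :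
    intKron Z a * intKron W b = intKron (Z * W) (a * b) := by
  ext c d
  simp only [intKron_apply, Matrix.mul_apply, Int.cast_sum, Int.cast_mul, Finset.sum_mul]
  refine Finset.sum_congr rfl fun e _ => ?_
  rw [mul_assoc, ← mul_assoc a, ← (Int.cast_commute (W e d) a).eq, mul_assoc, mul_assoc]

theorem intKron_neg_left (Z : Matrix (Fin 4) (Fin 4) ℤ) (b : B) :
    intKron (-Z) b = -intKron Z b := by ext c d; simp [intKron_apply]

theorem intKron_neg_right (Z : Matrix (Fin 4) (Fin 4) ℤ) (b : B) :
    intKron Z (-b) = -intKron Z b := by ext c d; simp [intKron_apply]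

theorem intKron_sum (Z : Matrix (Fin 4) (Fin 4) ℤ) {ι : Type*} (s : Finset ι) (f : ι → B) :
    intKron Z (∑ i ∈ s, f i) = ∑ i ∈ s, intKron Z (f i) := by
  ext c d; simp [intKron_apply, Finset.mul_sum, Matrix.sum_apply]

theorem intKron_one : intKron 1 (1 : B) = 1 := by
  ext c d; by_cases h : c = d <;> simp [intKron_apply, Matrix.one_apply, h]

theorem intKron_zero (Z : Matrix (Fin 4) (Fin 4) ℤ) : intKron Z (0 : B) = 0 := by
  ext c d; simp [intKron_apply]

end intKron

/-- The twist of a matrix by the matrices `quatMat i j`. -/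
def quatTwist {B : Type*} [Ring B] (X : Matrix (Fin 3) (Fin 3) B) :
    Matrix (Fin 3) (Fin 3) (Matrix (Fin 4) (Fin 4) B) :=
  Matrix.of fun i j => intKron (quatMat i j) (X i j)

theorem quatTwist_apply {B : Type*} [Ring B] (X : Matrix (Fin 3) (Fin 3) B) (i j : Fin 3) :
    quatTwist X i j = intKron (quatMat i j) (X i j) := rfl

theorem quatTwist_mul_transpose {B : Type*} [Ring B] {X : Matrix (Fin 3) (Fin 3) B}
    (h : X * Xᵀ = 1) : quatTwist X * (quatTwist X)ᵀ = 1 := by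
  ext1 i j
  have := congrFun (congrFun h i) j
  simp only [Matrix.mul_apply, Matrix.transpose_apply] at this
  simp only [Matrix.mul_apply, Matrix.transpose_apply, quatTwist_apply, intKron_mul,
    quatMat_row_row, ← intKron_sum, this]
  by_cases hij : i = j
  · subst hij
    simp [quatMat_sq, intKron_one]
  · simp [hij, intKron_zero]

theorem quatTwist_transpose_mul {B : Type*} [Ring B] {X : Matrix (Fin 3) (Fin 3) B}
    (h : Xᵀ * X = 1) : (quatTwist X)ᵀ * quatTwist X = 1 := by
  ext1 i j
  have := congrFun (congrFun h i) j
  simp only [Matrix.mul_apply, Matrix.transpose_apply] at this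
  simp only [Matrix.mul_apply, Matrix.transpose_apply, quatTwist_apply, intKron_mul,
    quatMat_col_col, ← intKron_sum, this]
  by_cases hij : i = j
  · subst hij
    simp [quatMat_sq, intKron_one]
  · simp [hij, intKron_zero]

/-- Twisting a special orthogonal matrix over a commutative ring gives the relations of
`SO_{-1}(3)`. -/
theorem SOm3Relations.quatTwist {S : Type*} [CommRing S] {X : Matrix (Fin 3) (Fin 3) S}
    (h : X * Xᵀ = 1) (hd : X.det = 1) : SOm3Relations (quatTwist X) where
  mul_transpose := quatTwist_mul_transpose h
  transpose_mul := quatTwist_transpose_mul (mul_eq_one_comm.1 h)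
  anticomm_row i j k hk := by
    rw [quatTwist_apply, quatTwist_apply, intKron_mul, intKron_mul, quatMat_row i j k hk,
      intKron_neg_left, mul_comm]
  anticomm_col i j k hk := by
    rw [quatTwist_apply, quatTwist_apply, intKron_mul, intKron_mul, quatMat_col i j k hk,
      intKron_neg_left, mul_comm]
  comm i j k l h h' := by
    rw [quatTwist_apply, quatTwist_apply, intKron_mul, intKron_mul, quatMat_comm i j k l h h',
      mul_comm]
  perm_eq_one := by
    rw [SOm3Relations.sum_perm fun a b c => _root_.quatTwist X 0 a * _root_.quatTwist X 1 b *
      _root_.quatTwist X 2 c]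
    simp only [quatTwist_apply, intKron_mul]
    -- The quaternionic product along σ is the sign of σ, so the permanent of the twist is the
    -- determinant of `X`.
    rw [show quatMat 0 0 * quatMat 1 1 * quatMat 2 2 = 1 by decide,
      show quatMat 0 0 * quatMat 1 2 * quatMat 2 1 = -1 by decide,
      show quatMat 0 1 * quatMat 1 0 * quatMat 2 2 = -1 by decide,
      show quatMat 0 1 * quatMat 1 2 * quatMat 2 0 = 1 by decide,
      show quatMat 0 2 * quatMat 1 0 * quatMat 2 1 = 1 by decide,
      show quatMat 0 2 * quatMat 1 1 * quatMat 2 0 = -1 by decide]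
    rw [Matrix.det_fin_three] at hd
    refine Eq.trans ?_ intKron_one
    rw [← hd]
    ext c d
    simp only [Matrix.add_apply, intKron_apply, Matrix.neg_apply]
    push_cast
    ring

/-- The untwisted generators commute. -/
theorem quatTwist_gen_commute (i j k l : Fin 3) :
    quatTwist PolSOm3.gen i j * quatTwist PolSOm3.gen k l =
      quatTwist PolSOm3.gen k l * quatTwist PolSOm3.gen i j := by
  have h := PolSOm3.relations_gen
  simp only [quatTwist_apply, intKron_mul]
  by_cases hik : i = k
  · subst hik
    by_cases hjl : j = l
    · rw [hjl]
    · rw [quatMat_row i j l (Ne.symm hjl), h.anticomm_row i j l (Ne.symm hjl), intKron_neg_left,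
        intKron_neg_right, neg_neg]
  · by_cases hjl : j = l
    · subst hjl
      rw [quatMat_col i j k (Ne.symm hik), h.anticomm_col i j k (Ne.symm hik), intKron_neg_left,
        intKron_neg_right, neg_neg]
    · rw [quatMat_comm i j k l hik hjl, h.comm i j k l hik hjl]

/-- The determinant of the untwisted generators. -/
theorem quatTwist_gen_det :
    quatTwist PolSOm3.gen 0 0 * quatTwist PolSOm3.gen 1 1 * quatTwist PolSOm3.gen 2 2 -
    quatTwist PolSOm3.gen 0 0 * quatTwist PolSOm3.gen 1 2 * quatTwist PolSOm3.gen 2 1 -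
    quatTwist PolSOm3.gen 0 1 * quatTwist PolSOm3.gen 1 0 * quatTwist PolSOm3.gen 2 2 +
    quatTwist PolSOm3.gen 0 1 * quatTwist PolSOm3.gen 1 2 * quatTwist PolSOm3.gen 2 0 +
    quatTwist PolSOm3.gen 0 2 * quatTwist PolSOm3.gen 1 0 * quatTwist PolSOm3.gen 2 1 -
    quatTwist PolSOm3.gen 0 2 * quatTwist PolSOm3.gen 1 1 * quatTwist PolSOm3.gen 2 0 = 1 := by
  have hd := PolSOm3.relations_gen.perm_eq_one
  rw [SOm3Relations.sum_perm fun a b c => PolSOm3.gen 0 a * PolSOm3.gen 1 b *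
      PolSOm3.gen 2 c] at hd
  simp only [quatTwist_apply, intKron_mul]
  rw [show quatMat 0 0 * quatMat 1 1 * quatMat 2 2 = 1 by decide,
      show quatMat 0 0 * quatMat 1 2 * quatMat 2 1 = -1 by decide,
      show quatMat 0 1 * quatMat 1 0 * quatMat 2 2 = -1 by decide,
      show quatMat 0 1 * quatMat 1 2 * quatMat 2 0 = 1 by decide,
      show quatMat 0 2 * quatMat 1 0 * quatMat 2 1 = 1 by decide,
      show quatMat 0 2 * quatMat 1 1 * quatMat 2 0 = -1 by decide]
  refine Eq.trans ?_ intKron_one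
  rw [← hd]
  ext c d
  simp only [Matrix.add_apply, Matrix.sub_apply, intKron_apply, intKron_neg_left,
    Matrix.neg_apply]
  noncomm_ring

/-! ### Untwisting: a faithful representation over a commutative ring. -/

namespace PolSOm3

/-- The representation of `Pol(SO_{-1}(3))` attached to a special orthogonal matrix over a
commutative algebra. -/
noncomputable def twistRep {S : Type*} [CommRing S] [Algebra ℂ S] (X : Matrix (Fin 3) (Fin 3) S)
    (h : X * Xᵀ = 1) (hd : X.det = 1) : PolSOm3 →ₐ[ℂ] Matrix (Fin 4) (Fin 4) S :=
  lift (quatTwist X) (.quatTwist h hd)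

theorem twistRep_gen {S : Type*} [CommRing S] [Algebra ℂ S] (X : Matrix (Fin 3) (Fin 3) S)
    (h : X * Xᵀ = 1) (hd : X.det = 1) (i j : Fin 3) :
    twistRep X h hd (gen i j) = intKron (quatMat i j) (X i j) := by
  rw [twistRep, lift_gen, quatTwist_apply]

/-- The algebra generated by the untwisted generators. -/
noncomputable def untwist : Subalgebra ℂ (Matrix (Fin 4) (Fin 4) PolSOm3) :=
  Algebra.adjoin ℂ (Set.range fun p : Fin 3 × Fin 3 => quatTwist gen p.1 p.2)

noncomputable instance : CommRing untwist where
  __ := (inferInstance : Ring untwist)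
  mul_comm := by
    have : IsMulCommutative untwist := Algebra.isMulCommutative_adjoin ℂ (by
      rintro _ ⟨p, rfl⟩ _ ⟨q, rfl⟩
      exact quatTwist_gen_commute _ _ _ _)
    exact fun a b => this.is_comm.comm a b

/-- The matrix of untwisted generators. -/
noncomputable def untwistGen : Matrix (Fin 3) (Fin 3) untwist :=
  Matrix.of fun i j => ⟨quatTwist gen i j, Algebra.subset_adjoin ⟨(i, j), rfl⟩⟩

theorem coe_untwistGen (i j : Fin 3) :
    ((untwistGen i j : untwist) : Matrix (Fin 4) (Fin 4) PolSOm3) = quatTwist gen i j := rfl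

theorem untwistGen_mul_transpose : untwistGen * untwistGenᵀ = 1 := by
  ext1 i j
  apply Subtype.ext
  have := congrFun (congrFun (quatTwist_mul_transpose relations_gen.mul_transpose) i) j
  simp only [Matrix.mul_apply, Matrix.transpose_apply] at this ⊢
  rw [AddSubmonoidClass.coe_finsetSum]
  refine Eq.trans this ?_
  by_cases h : i = j <;> simp [Matrix.one_apply, h]

theorem untwistGen_det : untwistGen.det = 1 := by
  rw [Matrix.det_fin_three]
  apply Subtype.ext
  exact quatTwist_gen_det

/-- The twist of the untwisted generators gives back the original ones. -/
theorem sum_twistRep_untwistGen (x : PolSOm3) (b c : Fin 4) :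
    ∑ d, ((twistRep untwistGen untwistGen_mul_transpose untwistGen_det x c d : untwist) :
      Matrix (Fin 4) (Fin 4) PolSOm3) b d = if b = c then x else 0 := by
  -- Read the image T of `x` as a matrix over `PolSOm3` with rows (c, b) and columns (d, f). With w
  -- = ∑ e_d ⊗ e_d the claim is T w = w x, a property inherited by sums and products. On a generator
  -- it reads (Z ⊗ Z) w = w with Z = `quatMat i j`, which holds because Z is symmetric of square 1.
  induction x using induction generalizing b c with
  | hs r =>
    rw [AlgHom.commutes, Finset.sum_eq_single c]
    · simp only [Matrix.algebraMap_matrix_apply, if_true, Subalgebra.coe_algebraMap]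
    · intro d _ hd
      simp [Matrix.algebraMap_matrix_apply, hd.symm]
    · simp
  | hg i j =>
    have h1 : ∑ d, quatMat i j b d * quatMat i j c d = if b = c then 1 else 0 := by
      have h2 := congrFun (congrFun (quatMat_sq i j) b) c
      rw [Matrix.mul_apply, Matrix.one_apply] at h2
      rw [← h2]
      refine Finset.sum_congr rfl fun d _ => ?_
      rw [← congrFun (congrFun (quatMat_transpose i j) d) c, Matrix.transpose_apply]
    have h3 : ∀ d, ((twistRep untwistGen untwistGen_mul_transpose untwistGen_det (gen i j) c d :
        untwist) : Matrix (Fin 4) (Fin 4) PolSOm3) b d =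
        ((quatMat i j b d * quatMat i j c d : ℤ) : PolSOm3) * gen i j := by
      intro d
      rw [twistRep_gen, intKron_apply, mul_comm (quatMat i j b d), Int.cast_mul, mul_assoc]
      simp only [MulMemClass.coe_mul, coe_untwistGen, SubringClass.coe_intCast, quatTwist_apply]
      rw [← zsmul_eq_mul, Matrix.smul_apply, zsmul_eq_mul, intKron_apply]
    simp only [h3, ← Finset.sum_mul, ← Int.cast_sum, h1]
    split_ifs <;> simp
  | hm x y hx hy =>
    have h1 : ∀ d, ((twistRep untwistGen untwistGen_mul_transpose untwistGen_det (x * y) c d :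
        untwist) : Matrix (Fin 4) (Fin 4) PolSOm3) b d =
        ∑ e, ∑ f, ((twistRep untwistGen untwistGen_mul_transpose untwistGen_det x c e :
        untwist) : Matrix (Fin 4) (Fin 4) PolSOm3) b f *
        ((twistRep untwistGen untwistGen_mul_transpose untwistGen_det y e d :
        untwist) : Matrix (Fin 4) (Fin 4) PolSOm3) f d := by
      intro d
      rw [map_mul, Matrix.mul_apply, AddSubmonoidClass.coe_finsetSum, Matrix.sum_apply]
      refine Finset.sum_congr rfl fun e _ => ?_
      rw [MulMemClass.coe_mul, Matrix.mul_apply]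
    simp only [h1]
    rw [Finset.sum_comm]
    have h2 : ∀ e, ∑ d, ∑ f,
        ((twistRep untwistGen untwistGen_mul_transpose untwistGen_det x c e :
        untwist) : Matrix (Fin 4) (Fin 4) PolSOm3) b f *
        ((twistRep untwistGen untwistGen_mul_transpose untwistGen_det y e d :
        untwist) : Matrix (Fin 4) (Fin 4) PolSOm3) f d =
        ((twistRep untwistGen untwistGen_mul_transpose untwistGen_det x c e :
        untwist) : Matrix (Fin 4) (Fin 4) PolSOm3) b e * y := by
      intro e
      rw [Finset.sum_comm]
      simp only [← Finset.mul_sum, hy]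
      simp
    simp only [h2, ← Finset.sum_mul, hx]
    split_ifs <;> simp
  | ha x y hx hy =>
    simp only [map_add, Matrix.add_apply, AddMemClass.coe_add, Finset.sum_add_distrib, hx, hy]
    split_ifs <;> simp

theorem eq_zero_of_twistRep_untwistGen (x : PolSOm3)
    (h : twistRep untwistGen untwistGen_mul_transpose untwistGen_det x = 0) : x = 0 := by
  simpa [h] using (sum_twistRep_untwistGen x 0 0).symm

end PolSOm3

/-! ### Quaternion coordinates on rotations. -/

/-- For the rotation matrix `X` of a unit quaternion `q`, this is `4 q qᵀ`. -/
def quatGram {S : Type*} [CommRing S] (X : Matrix (Fin 3) (Fin 3) S) :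
    Matrix (Fin 4) (Fin 4) S := 1 + ∑ i, ∑ j, intKron (quatMat i j) (X i j)

section quatGram

variable {S : Type*} [CommRing S] {X : Matrix (Fin 3) (Fin 3) S}

theorem transpose_eq_adjugate (h : X * Xᵀ = 1) (hd : X.det = 1) : Xᵀ = X.adjugate := by
  have h2 : Xᵀ * (X * X.adjugate) = Xᵀ := by rw [Matrix.mul_adjugate, hd, one_smul, mul_one]
  rw [← h2, ← mul_assoc, mul_eq_one_comm.1 h, one_mul]

theorem quatGram_eq (X : Matrix (Fin 3) (Fin 3) S) : quatGram X =
    !![1 + X 0 0 + X 1 1 + X 2 2, X 2 1 - X 1 2, X 0 2 - X 2 0, X 1 0 - X 0 1;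
      X 2 1 - X 1 2, 1 + X 0 0 - X 1 1 - X 2 2, X 0 1 + X 1 0, X 0 2 + X 2 0;
      X 0 2 - X 2 0, X 0 1 + X 1 0, 1 - X 0 0 + X 1 1 - X 2 2, X 1 2 + X 2 1;
      X 1 0 - X 0 1, X 0 2 + X 2 0, X 1 2 + X 2 1, 1 - X 0 0 - X 1 1 + X 2 2] := by
  ext a b
  fin_cases a <;> fin_cases b <;>
    simp [quatGram, Fin.sum_univ_three, intKron_apply, quatMat] <;> ring

/-- For the rotation of a unit quaternion the matrix is 4 q qᵀ, of rank one. Over a general ring no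
q need exist; the minors vanish as consequences of the orthogonality of rows and columns together
with Xᵀ = adj X. -/
theorem quatGram_minor (h : X * Xᵀ = 1) (hd : X.det = 1) (a b c : Fin 4) :
    quatGram X a a * quatGram X b c = quatGram X a b * quatGram X a c := by
  have e1 : ∀ i j, X i 0 * X j 0 + X i 1 * X j 1 + X i 2 * X j 2 = if i = j then 1 else 0 := by
    intro i j
    rw [← Matrix.one_apply, ← h, Matrix.mul_apply, Fin.sum_univ_three]
    rfl
  have e2 : ∀ i j, X 0 i * X 0 j + X 1 i * X 1 j + X 2 i * X 2 j = if i = j then 1 else 0 := by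
    intro i j
    rw [← Matrix.one_apply, ← mul_eq_one_comm.1 h, Matrix.mul_apply, Fin.sum_univ_three]
    rfl
  have e3 := fun i j => congrFun (congrFun (transpose_eq_adjugate h hd) i) j
  rw [Matrix.adjugate_fin_three] at e3
  have r00 := e1 0 0
  have r11 := e1 1 1
  have r22 := e1 2 2
  have r01 := e1 0 1
  have r02 := e1 0 2
  have r12 := e1 1 2
  have s00 := e2 0 0
  have s11 := e2 1 1
  have s22 := e2 2 2
  have s01 := e2 0 1
  have s02 := e2 0 2
  have s12 := e2 1 2
  have t00 := e3 0 0
  have t01 := e3 0 1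
  have t02 := e3 0 2
  have t10 := e3 1 0
  have t11 := e3 1 1
  have t12 := e3 1 2
  have t20 := e3 2 0
  have t21 := e3 2 1
  have t22 := e3 2 2
  clear e1 e2 e3 hd h
  simp at r00 r11 r22 r01 r02 r12 s00 s11 s22 s01 s02 s12 t00 t01 t02 t10 t11 t12 t20 t21 t22
  rw [quatGram_eq]
  generalize X 0 0 = x00 at *
  generalize X 0 1 = x01 at *
  generalize X 0 2 = x02 at *
  generalize X 1 0 = x10 at *
  generalize X 1 1 = x11 at *
  generalize X 1 2 = x12 at *
  generalize X 2 0 = x20 at *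
  generalize X 2 1 = x21 at *
  generalize X 2 2 = x22 at *
  fin_cases a <;> fin_cases b <;> fin_cases c <;> simp <;> grind

variable (X)

theorem quatGram_trace : ∑ a, quatGram X a a = 4 := by
  rw [quatGram_eq, Fin.sum_univ_four]
  simp
  ring

theorem sum_quatMat_mul (G : Matrix (Fin 4) (Fin 4) S) (i j : Fin 3) :
    ∑ b, ∑ c, (quatMat i j b c : S) * G b c =
      !![G 0 0 + G 1 1 - G 2 2 - G 3 3, -G 0 3 + G 1 2 + G 2 1 - G 3 0,
          G 0 2 + G 1 3 + G 2 0 + G 3 1;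
        G 0 3 + G 1 2 + G 2 1 + G 3 0, G 0 0 - G 1 1 + G 2 2 - G 3 3,
          -G 0 1 - G 1 0 + G 2 3 + G 3 2;
        -G 0 2 + G 1 3 - G 2 0 + G 3 1, G 0 1 + G 1 0 + G 2 3 + G 3 2,
          G 0 0 - G 1 1 - G 2 2 + G 3 3] i j := by
  simp only [Fin.sum_univ_four]
  fin_cases i <;> fin_cases j <;> simp only [Fin.reduceFinMk, Fin.mk_one, Fin.zero_eta] <;>
    simp only [quatMat, Matrix.cons_val] <;> simp <;> ring1

/-- The identity and the nine `quatMat i j` are orthogonal for the trace form, each of square norm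
4, so this pairing reads off the coefficient of `quatMat i j`. -/
theorem sum_quatMat_mul_quatGram (i j : Fin 3) :
    ∑ b, ∑ c, (quatMat i j b c : S) * quatGram X b c = 4 * X i j := by
  rw [sum_quatMat_mul, quatGram_eq]
  fin_cases i <;> fin_cases j <;> simp <;> ring1

end quatGram

/-- The entries of the rotation matrix of a quaternion `q`, as quadratic forms in `q`. -/
def quatRotation {S : Type*} [CommRing S] (q : Fin 4 → S) : Matrix (Fin 3) (Fin 3) S :=
  Matrix.of fun i j => ∑ b, ∑ c, (quatMat i j b c : S) * (q b * q c)

section quatRotation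

variable {S : Type*} [CommRing S] (q : Fin 4 → S)

theorem quatRotation_eq : quatRotation q =
    !![q 0 ^ 2 + q 1 ^ 2 - q 2 ^ 2 - q 3 ^ 2, 2 * (q 1 * q 2 - q 0 * q 3),
        2 * (q 0 * q 2 + q 1 * q 3);
      2 * (q 0 * q 3 + q 1 * q 2), q 0 ^ 2 - q 1 ^ 2 + q 2 ^ 2 - q 3 ^ 2,
        2 * (q 2 * q 3 - q 0 * q 1);
      2 * (q 1 * q 3 - q 0 * q 2), 2 * (q 0 * q 1 + q 2 * q 3),
        q 0 ^ 2 - q 1 ^ 2 - q 2 ^ 2 + q 3 ^ 2] := by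
  ext i j
  refine (sum_quatMat_mul (Matrix.of fun b c => q b * q c) i j).trans ?_
  fin_cases i <;> fin_cases j <;> simp <;> ring1

variable {q}

theorem quatRotation_mul_transpose (h : ∑ a, q a ^ 2 = 1) :
    quatRotation q * (quatRotation q)ᵀ = 1 := by
  rw [Fin.sum_univ_four] at h
  -- Before normalisation R Rᵀ = |q|⁴; similarly det R = |q|⁶ below.
  have h2 : (q 0 ^ 2 + q 1 ^ 2 + q 2 ^ 2 + q 3 ^ 2) ^ 2 = 1 := by rw [h, one_pow]
  rw [quatRotation_eq]
  ext i j
  fin_cases i <;> fin_cases j <;> simp [Matrix.mul_apply, Fin.sum_univ_three] <;>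
    first | ring1 | linear_combination h2

theorem quatRotation_det (h : ∑ a, q a ^ 2 = 1) : (quatRotation q).det = 1 := by
  rw [Fin.sum_univ_four] at h
  have h2 : (q 0 ^ 2 + q 1 ^ 2 + q 2 ^ 2 + q 3 ^ 2) ^ 3 = 1 := by rw [h, one_pow]
  rw [quatRotation_eq, Matrix.det_fin_three]
  simp
  linear_combination h2

theorem quatGram_quatRotation (h : ∑ a, q a ^ 2 = 1) (a b : Fin 4) :
    quatGram (quatRotation q) a b = 4 * (q a * q b) := by
  rw [Fin.sum_univ_four] at h
  rw [quatGram_eq, quatRotation_eq]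
  fin_cases a <;> fin_cases b <;> simp <;> first | ring1 | linear_combination -h

end quatRotation

theorem MvPolynomial.IsHomogeneous.eval_smul {σ R : Type*} [CommRing R] {p : MvPolynomial σ R}
    {n : ℕ} (hp : p.IsHomogeneous n) (r : R) (y : σ → R) :
    eval (r • y) p = r ^ n * eval y p := by
  rw [eval_eq, eval_eq, Finset.mul_sum]
  refine Finset.sum_congr rfl fun d hd => ?_
  rw [hp.degree_eq_sum_deg_support hd, ← Finset.prod_pow_eq_pow_sum]
  simp only [Pi.smul_apply, smul_eq_mul, mul_pow, Finset.prod_mul_distrib]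
  ring

/-! ### Real rotations separate points. -/

namespace PolSOm3

open MvPolynomial in
/-- In the representation `twistRep X`, every element is locally given by homogeneous polynomials
in the entries of any row of `quatGram X`. -/
theorem exists_homogeneous (x : PolSOm3) : ∃ (n : ℕ) (p : Matrix (Fin 4) (Fin 4)
    (MvPolynomial (Fin 4) ℂ)), (∀ c d, (p c d).IsHomogeneous (2 * n)) ∧
    ∀ {S : Type} [CommRing S] [Algebra ℂ S] (X : Matrix (Fin 3) (Fin 3) S) (h : X * Xᵀ = 1)
      (hd : X.det = 1) (a : Fin 4),
      quatGram X a a ^ n • twistRep X h hd x = p.map (aeval (quatGram X a)) := by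
  induction x using induction with
  | hs r =>
    refine ⟨0, Matrix.diagonal fun _ => C r, fun c d => ?_, fun X h hd a => ?_⟩
    · by_cases hcd : c = d
      · subst hcd
        simpa using isHomogeneous_C _ _
      · simpa [hcd] using isHomogeneous_zero _ _ _
    · ext c d
      by_cases hcd : c = d <;> simp [Matrix.algebraMap_matrix_apply, hcd]
  | hg i j =>
    -- The polynomial is the quadratic form expressing a rotation entry through q. On row `a` of the
    -- Gram matrix G, the relation G_aa G_bc = G_ab G_ac turns it into G_aa · 4 X_ij; the factor 1/4
    -- removes the 4.
    refine ⟨1, Matrix.of fun c d => C ((1 / 4 : ℂ) * quatMat i j c d) *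
      ∑ b, ∑ c, C (quatMat i j b c : ℂ) * (X b * X c), fun c d => ?_, @fun S _ _ X h hd a => ?_⟩
    · refine (IsHomogeneous.sum _ _ _ fun b _ => IsHomogeneous.sum _ _ _ fun c _ => ?_).C_mul _
      exact ((isHomogeneous_X _ _).mul (isHomogeneous_X _ _)).C_mul _
    · ext c d
      have h1 : ∑ b, ∑ c, (quatMat i j b c : S) * (quatGram X a b * quatGram X a c) =
          quatGram X a a * (4 * X i j) := by
        rw [← sum_quatMat_mul_quatGram, Finset.mul_sum]
        refine Finset.sum_congr rfl fun b _ => ?_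
        rw [Finset.mul_sum]
        refine Finset.sum_congr rfl fun c _ => ?_
        rw [← quatGram_minor h hd]
        ring
      simp only [Matrix.smul_apply, twistRep_gen, intKron_apply, Matrix.map_apply, Matrix.of_apply,
        map_mul, map_sum, aeval_C, aeval_X, map_intCast, h1, pow_one, smul_eq_mul]
      have h2 : algebraMap ℂ S (1 / 4) * 4 = 1 := by
        rw [← map_ofNat (algebraMap ℂ S) 4, ← map_mul]
        norm_num
      linear_combination (-(quatMat i j c d : S) * quatGram X a a * X i j) * h2
  | hm x y hx hy =>
    obtain ⟨n, p, hp, hpx⟩ := hx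
    obtain ⟨m, r, hr, hry⟩ := hy
    refine ⟨n + m, p * r, fun c d => ?_, fun X h hd a => ?_⟩
    · rw [Matrix.mul_apply]
      refine IsHomogeneous.sum _ _ _ fun e _ => ?_
      rw [mul_add]
      exact (hp c e).mul (hr e d)
    · rw [Matrix.map_mul, ← hpx X h hd, ← hry X h hd, map_mul, pow_add, smul_mul_smul_comm]
  | ha x y hx hy =>
    obtain ⟨n, p, hp, hpx⟩ := hx
    obtain ⟨m, r, hr, hry⟩ := hy
    have hs : (C (1 / 4 : ℂ) * ∑ b : Fin 4, X b ^ 2 : MvPolynomial (Fin 4) ℂ).IsHomogeneous 2 :=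
      (IsHomogeneous.sum _ _ _ fun b _ => isHomogeneous_X_pow _ _).C_mul _
    -- The two summands must be brought to the same degree. The form ¼ ∑ X_b² takes the value G_aa
    -- on row `a`, because the trace of G is 4, so its powers supply the missing powers of G_aa.
    refine ⟨n + m, (C (1 / 4 : ℂ) * ∑ b : Fin 4, X b ^ 2) ^ m • p +
      (C (1 / 4 : ℂ) * ∑ b : Fin 4, X b ^ 2) ^ n • r, fun c d => ?_, @fun S _ _ X h hd a => ?_⟩
    · refine IsHomogeneous.add ?_ ?_
      · rw [mul_add, add_comm]
        exact (hs.pow m).mul (hp c d)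
      · rw [mul_add]
        exact (hs.pow n).mul (hr c d)
    · have h1 : aeval (quatGram X a) (C (1 / 4 : ℂ) * ∑ b : Fin 4, MvPolynomial.X b ^ 2) =
          quatGram X a a := by
        have h2 : ∑ b, quatGram X a b ^ 2 = quatGram X a a * 4 := by
          rw [← quatGram_trace X, Finset.mul_sum]
          refine Finset.sum_congr rfl fun b _ => ?_
          have h3 : quatGram X b a = quatGram X a b := by
            rw [quatGram_eq]
            fin_cases a <;> fin_cases b <;> rfl
          have h4 := quatGram_minor h hd b a a
          rw [h3] at h4
          rw [sq, ← h4, mul_comm]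
        have h5 : algebraMap ℂ S (1 / 4) * 4 = 1 := by
          rw [← map_ofNat (algebraMap ℂ S) 4, ← map_mul]
          norm_num
        simp only [map_mul, map_sum, map_pow, aeval_C, aeval_X, h2]
        linear_combination quatGram X a a * h5
      have h6 := hpx X h hd a
      have h7 := hry X h hd a
      ext c d
      have h8 := congrFun (congrFun h6 c) d
      have h9 := congrFun (congrFun h7 c) d
      simp only [Matrix.smul_apply, Matrix.map_apply, smul_eq_mul] at h8 h9
      simp only [Matrix.smul_apply, Matrix.map_apply, Matrix.add_apply, map_add, smul_eq_mul,
        map_mul, map_pow (aeval (quatGram X a)) _ m, map_pow (aeval (quatGram X a)) _ n] at h1 ⊢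
      rw [h1, ← h8, ← h9, pow_add]
      ring

open MvPolynomial in
/-- The representations attached to rotations separate the points of `Pol(SO_{-1}(3))`. -/
theorem eq_zero_of_twistRep_quatRotation (x : PolSOm3)
    (hx : ∀ (q : Fin 4 → ℂ) (hq : ∑ a, q a ^ 2 = 1), (∀ a, (q a).im = 0) →
      (∃ a ≠ 0, q a ≠ 0) →
      twistRep (quatRotation q) (quatRotation_mul_transpose hq) (quatRotation_det hq) x = 0) :
    x = 0 := by
  obtain ⟨n, p, hp, hpx⟩ := exists_homogeneous x
  -- A polynomial vanishing at all points with positive real coordinates is zero. For such a point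
  -- y, normalised to q, row 0 of the Gram matrix is a nonzero multiple of y, and homogeneity
  -- removes the multiple.
  have hp0 : p = 0 := by
    ext1 c d
    refine MvPolynomial.funext_set (fun _ => Complex.ofReal '' Set.Ioi 0) (fun _ =>
      (Set.Ioi_infinite _).image Complex.ofReal_injective.injOn) fun y hy => ?_
    have hy' : ∀ a, ∃ t : ℝ, 0 < t ∧ (t : ℂ) = y a := fun a => hy a trivial
    choose t ht hty using hy'
    have hpos : 0 < ∑ a, t a ^ 2 := Finset.sum_pos (fun a _ => pow_pos (ht a) 2) ⟨0, by simp⟩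
    set r := √(∑ a, t a ^ 2) with hr
    have hr0 : 0 < r := Real.sqrt_pos.2 hpos
    have hr2 : r ^ 2 = ∑ a, t a ^ 2 := Real.sq_sqrt hpos.le
    set q : Fin 4 → ℂ := fun a => ((t a / r : ℝ) : ℂ) with hqdef
    have hq : ∑ a, q a ^ 2 = 1 := by
      simp only [hqdef, ← Complex.ofReal_pow, ← Complex.ofReal_sum, div_pow, ← Finset.sum_div]
      rw [← hr2, div_self (pow_ne_zero 2 hr0.ne'), Complex.ofReal_one]
    have hq0 : ∀ a, q a ≠ 0 := fun a =>
      Complex.ofReal_ne_zero.2 (div_pos (ht a) hr0).ne'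
    have h1 := hpx (quatRotation q) (quatRotation_mul_transpose hq) (quatRotation_det hq) 0
    rw [hx q hq (fun a => Complex.ofReal_im _) ⟨1, by decide, hq0 1⟩, smul_zero] at h1
    have h2 := congrFun (congrFun h1 c) d
    have h3 : quatGram (quatRotation q) 0 = (4 * q 0 / r) • y := by
      ext b
      rw [quatGram_quatRotation hq, Pi.smul_apply, smul_eq_mul, ← hty]
      simp only [hqdef, Complex.ofReal_div]
      ring
    rw [Matrix.map_apply, h3, MvPolynomial.aeval_eq_eval] at h2
    rw [(hp c d).eval_smul] at h2
    rw [Matrix.zero_apply, map_zero]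
    rw [Matrix.zero_apply] at h2
    refine (mul_eq_zero.1 h2.symm).resolve_left (pow_ne_zero _ ?_)
    exact div_ne_zero (mul_ne_zero (by norm_num) (hq0 0)) (Complex.ofReal_ne_zero.2 hr0.ne')
  apply eq_zero_of_twistRep_untwistGen
  set T := twistRep untwistGen untwistGen_mul_transpose untwistGen_det x with hT
  -- The trace of the Gram matrix is 4, so its diagonal entries, and also their n-th powers,
  -- generate the unit ideal. This partition of unity gives T = 0 with no prior knowledge that the
  -- coordinate ring is reduced.
  have h1 : ∀ a, quatGram untwistGen a a ^ n • T = 0 := by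
    intro a
    rw [hT, hpx untwistGen untwistGen_mul_transpose untwistGen_det a, hp0]
    ext1
    simp
  have h2 : (Ideal.span (Set.range fun a => quatGram untwistGen a a)) = ⊤ := by
    rw [Ideal.eq_top_iff_one]
    have h3 : (1 : untwist) = algebraMap ℂ untwist (1 / 4) * ∑ a, quatGram untwistGen a a := by
      rw [quatGram_trace, ← map_ofNat (algebraMap ℂ untwist) 4, ← map_mul]
      norm_num
    rw [h3]
    exact Ideal.mul_mem_left _ _ (Ideal.sum_mem _ fun a _ => Ideal.subset_span ⟨a, rfl⟩)
  have h4 := Ideal.span_pow_eq_top _ h2 n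
  have h5 : ∀ s : untwist, s ∈ Ideal.span ((fun x => x ^ n) ''
      (Set.range fun a => quatGram untwistGen a a)) → s • T = 0 := by
    intro s hs
    induction hs using Submodule.span_induction with
    | mem s hs => obtain ⟨_, ⟨a, rfl⟩, rfl⟩ := hs; exact h1 a
    | zero => exact zero_smul _ _
    | add s t _ _ hs ht => rw [add_smul, hs, ht, add_zero]
    | smul r s _ hs => rw [smul_assoc, hs, smul_zero]
  simpa using h5 1 (h4 ▸ trivial)

end PolSOm3

/-! ### Diagonal characters and skew-primitive functionals. -/

/-- The signed permutation matrix with entries `e j` in the positions `(p j, j)`. -/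
def signedPerm (p : Equiv.Perm (Fin 3)) (e : Fin 3 → ℤˣ) : Matrix (Fin 3) (Fin 3) ℤ :=
  Matrix.of fun i j => if i = p j then (e j : ℤ) else 0

set_option maxRecDepth 100000 in
theorem SOm3Relations.signedPerm : ∀ (p : Equiv.Perm (Fin 3)) (e : Fin 3 → ℤˣ),
    e 0 * e 1 * e 2 = 1 → SOm3Relations (signedPerm p e) := by
  have h1 : ∀ (p : Equiv.Perm (Fin 3)) (e : Fin 3 → ℤˣ),
      _root_.signedPerm p e * (_root_.signedPerm p e)ᵀ = 1 := by decide
  have h2 : ∀ (p : Equiv.Perm (Fin 3)) (e : Fin 3 → ℤˣ), ∀ i j k, k ≠ j →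
      _root_.signedPerm p e i j * _root_.signedPerm p e i k = 0 := by decide
  have h3 : ∀ (p : Equiv.Perm (Fin 3)) (e : Fin 3 → ℤˣ), ∀ i j k, k ≠ i →
      _root_.signedPerm p e i j * _root_.signedPerm p e k j = 0 := by decide
  have h4 : ∀ (p : Equiv.Perm (Fin 3)) (e : Fin 3 → ℤˣ), e 0 * e 1 * e 2 = 1 →
      ∑ σ : Equiv.Perm (Fin 3), _root_.signedPerm p e 0 (σ 0) * _root_.signedPerm p e 1 (σ 1) *
        _root_.signedPerm p e 2 (σ 2) = 1 := by decide
  intro p e he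
  exact ⟨h1 p e, mul_eq_one_comm.1 (h1 p e),
    fun i j k h => by rw [h2 p e i j k h, h2 p e i k j h.symm, neg_zero],
    fun i j k h => by rw [h3 p e i j k h, h3 p e k j i h.symm, neg_zero],
    fun i j k l _ _ => mul_comm _ _, h4 p e he⟩

/-- The signs of the diagonal matrices of determinant `1`. -/
def kleinSign (k i : Fin 3) : ℤˣ := if i = k then 1 else -1

/-- The symmetric matrix exchanging the two basis vectors different from the `k`-th. -/
def skewMat (k : Fin 3) : Matrix (Fin 3) (Fin 3) ℤ :=
  Matrix.of fun i j => if i ≠ j ∧ i ≠ k ∧ j ≠ k then 1 else 0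

/-- The matrix of values on the generators of the representation `PolSOm3.skewHom`. -/
def skewBlock (k : Fin 3) : Matrix (Fin 3) (Fin 3) (Matrix (Fin 2) (Fin 2) ℤ) :=
  Matrix.of fun i j => !![if i = j then 1 else 0, skewMat k i j;
    0, signedPerm 1 (kleinSign k) i j]

-- Tangent vectors are symmetric here rather than antisymmetric: with S = `skewMat k`, the corner of
-- the orthogonality relation at (i, j), i ≠ j, is S_ji + χ_k(a_jj) S_ij, and χ_k(a_jj) = -1
-- wherever S_ij is supported.
set_option maxRecDepth 100000 in
theorem SOm3Relations.skewBlock : ∀ k, SOm3Relations (skewBlock k) := by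
  have h1 : ∀ k, _root_.skewBlock k * (_root_.skewBlock k)ᵀ = 1 := by decide
  have h2 : ∀ k, (_root_.skewBlock k)ᵀ * _root_.skewBlock k = 1 := by decide
  have h3 : ∀ k, ∀ i j l, l ≠ j → _root_.skewBlock k i j * _root_.skewBlock k i l =
    -(_root_.skewBlock k i l * _root_.skewBlock k i j) := by decide
  have h4 : ∀ k, ∀ i j l, l ≠ i → _root_.skewBlock k i j * _root_.skewBlock k l j =
    -(_root_.skewBlock k l j * _root_.skewBlock k i j) := by decide
  have h5 : ∀ n, ∀ i j k l, i ≠ k → j ≠ l → _root_.skewBlock n i j * _root_.skewBlock n k l =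
    _root_.skewBlock n k l * _root_.skewBlock n i j := by decide
  have h6 : ∀ k, ∑ σ : Equiv.Perm (Fin 3), _root_.skewBlock k 0 (σ 0) * _root_.skewBlock k 1 (σ 1) *
        _root_.skewBlock k 2 (σ 2) = 1 := by decide
  exact fun k => ⟨h1 k, h2 k, h3 k, h4 k, h5 k, h6 k⟩

namespace PolSOm3

/-- The character of `Pol(SO_{-1}(3))` given by a signed permutation matrix. -/
noncomputable def signedChar (p : Equiv.Perm (Fin 3)) (e : Fin 3 → ℤˣ) (h : e 0 * e 1 * e 2 = 1) :
    PolSOm3 →ₐ[ℂ] ℂ :=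
  lift ((signedPerm p e).map (Int.castRingHom ℂ)) ((SOm3Relations.signedPerm p e h).map _)

theorem kleinSign_prod : ∀ k, kleinSign k 0 * kleinSign k 1 * kleinSign k 2 = 1 := by decide

/-- The characters given by the diagonal matrices. -/
noncomputable def kleinChar (k : Fin 3) : PolSOm3 →ₐ[ℂ] ℂ :=
  signedChar 1 (kleinSign k) (kleinSign_prod k)

theorem kleinChar_gen (k i j : Fin 3) :
    kleinChar k (gen i j) = if i = j then ((kleinSign k j : ℤ) : ℂ) else 0 := by
  rw [kleinChar, signedChar, lift_gen]
  simp only [Matrix.map_apply, signedPerm, Matrix.of_apply, Equiv.Perm.one_apply]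
  split_ifs with h <;> simp [h]

/-- A representation by upper triangular matrices, with the counit and a character on the
diagonal. -/
noncomputable def skewHom (k : Fin 3) : PolSOm3 →ₐ[ℂ] Matrix (Fin 2) (Fin 2) ℂ :=
  lift ((skewBlock k).map (Int.castRingHom ℂ).mapMatrix) ((SOm3Relations.skewBlock k).map _)

/-- The skew-primitive functional `X_k`. -/
noncomputable def skewFun (k : Fin 3) : PolSOm3 →ₗ[ℂ] ℂ where
  toFun x := skewHom k x 0 1
  map_add' x y := by rw [map_add, Matrix.add_apply]
  map_smul' r x := by rw [map_smul, Matrix.smul_apply]; rfl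

theorem skewHom_eq (k : Fin 3) (x : PolSOm3) :
    skewHom k x = !![counitHom x, skewFun k x; 0, kleinChar k x] := by
  have h : skewHom k x 0 0 = counitHom x ∧ skewHom k x 1 0 = 0 ∧
      skewHom k x 1 1 = kleinChar k x := by
    induction x using induction with
    | hs r => simp [Matrix.algebraMap_matrix_apply]
    | hg i j =>
      rw [skewHom, lift_gen, kleinChar_gen, counitHom_gen]
      simp only [skewBlock, Matrix.map_apply, RingHom.mapMatrix_apply, Matrix.of_apply, signedPerm]
      by_cases h : i = j <;> simp [h]
    | hm x y hx hy => simp [Matrix.mul_apply, hx, hy]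
    | ha x y hx hy => simp [hx, hy]
  ext i j
  fin_cases i <;> fin_cases j
  · exact h.1
  · rfl
  · exact h.2.1
  · exact h.2.2

theorem skewFun_gen (k i j : Fin 3) : skewFun k (gen i j) = skewMat k i j := by
  change skewHom k (gen i j) 0 1 = _
  rw [skewHom, lift_gen]
  simp [skewBlock]

theorem skewFun_mul (k : Fin 3) (x y : PolSOm3) :
    skewFun k (x * y) = counitHom x * skewFun k y + skewFun k x * kleinChar k y := by
  change skewHom k (x * y) 0 1 = _
  rw [map_mul, skewHom_eq k x, skewHom_eq k y]
  simp [Matrix.mul_apply]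

theorem skewFun_algebraMap (k : Fin 3) (r : ℂ) : skewFun k (algebraMap ℂ PolSOm3 r) = 0 := by
  change skewHom k (algebraMap ℂ PolSOm3 r) 0 1 = _
  simp [Matrix.algebraMap_matrix_apply]

/-! ### Translations, skew derivations and their anticommutators. -/

/-- Right translation by a linear functional. -/
noncomputable def transl (f : PolSOm3 →ₗ[ℂ] ℂ) : PolSOm3 →ₗ[ℂ] PolSOm3 :=
  (TensorProduct.rid ℂ PolSOm3).toLinearMap ∘ₗ f.lTensor PolSOm3 ∘ₗ comulHom.toLinearMap

/-- Right translation by a character. -/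
noncomputable def translR (χ : PolSOm3 →ₐ[ℂ] ℂ) : PolSOm3 →ₐ[ℂ] PolSOm3 :=
  ((Algebra.TensorProduct.rid ℂ ℂ PolSOm3).toAlgHom.comp
    (Algebra.TensorProduct.map (AlgHom.id ℂ PolSOm3) χ)).comp comulHom

/-- Left translation by a character. -/
noncomputable def translL (χ : PolSOm3 →ₐ[ℂ] ℂ) : PolSOm3 →ₐ[ℂ] PolSOm3 :=
  ((Algebra.TensorProduct.lid ℂ PolSOm3).toAlgHom.comp
    (Algebra.TensorProduct.map χ (AlgHom.id ℂ PolSOm3))).comp comulHom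

theorem translR_gen (χ : PolSOm3 →ₐ[ℂ] ℂ) (i j : Fin 3) :
    translR χ (gen i j) = ∑ k, χ (gen k j) • gen i k := by
  simp [translR]

theorem translL_gen (χ : PolSOm3 →ₐ[ℂ] ℂ) (i j : Fin 3) :
    translL χ (gen i j) = ∑ k, χ (gen i k) • gen k j := by
  simp [translL]

theorem translR_counit : translR counitHom = AlgHom.id ℂ PolSOm3 := by
  ext i j
  simp [translR_gen]

/-- The skew derivation of `Pol(SO_{-1}(3))` given by right translation by `X_k`. -/
noncomputable def skewDer (k : Fin 3) : PolSOm3 →ₗ[ℂ] PolSOm3 := transl (skewFun k)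

theorem skewDer_gen (k i j : Fin 3) :
    skewDer k (gen i j) = ∑ l, (skewMat k l j : PolSOm3) * gen i l := by
  simp [skewDer, transl, skewFun_gen, ← zsmul_eq_mul, Int.cast_smul_eq_zsmul]

theorem skewDer_algebraMap (k : Fin 3) (r : ℂ) : skewDer k (algebraMap ℂ PolSOm3 r) = 0 := by
  have h : skewFun k 1 = 0 := by simpa using skewFun_algebraMap k 1
  simp [skewDer, transl, Algebra.TensorProduct.algebraMap_apply, h]

theorem skewDer_mul (k : Fin 3) (x y : PolSOm3) :
    skewDer k (x * y) = x * skewDer k y + skewDer k x * translR (kleinChar k) y := by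
  have key : ∀ t s : PolSOm3 ⊗[ℂ] PolSOm3,
      TensorProduct.rid ℂ PolSOm3 ((skewFun k).lTensor PolSOm3 (t * s)) =
      Algebra.TensorProduct.rid ℂ ℂ PolSOm3 (Algebra.TensorProduct.map (AlgHom.id ℂ PolSOm3)
        counitHom t) * TensorProduct.rid ℂ PolSOm3 ((skewFun k).lTensor PolSOm3 s) +
      TensorProduct.rid ℂ PolSOm3 ((skewFun k).lTensor PolSOm3 t) *
        Algebra.TensorProduct.rid ℂ ℂ PolSOm3 (Algebra.TensorProduct.map (AlgHom.id ℂ PolSOm3)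
          (kleinChar k) s) := by
    intro t s
    induction t using TensorProduct.induction_on with
    | zero => simp
    | add t t' h h' => rw [add_mul, map_add, map_add, h, h']; simp only [map_add, add_mul]; abel
    | tmul a b =>
      induction s using TensorProduct.induction_on with
      | zero => simp
      | add t t' h h' => rw [mul_add, map_add, map_add, h, h']; simp only [map_add, mul_add]; abel
      | tmul c d =>
        simp only [Algebra.TensorProduct.tmul_mul_tmul, LinearMap.lTensor_tmul,
          TensorProduct.rid_tmul, Algebra.TensorProduct.map_tmul, AlgHom.id_apply,
          Algebra.TensorProduct.rid_tmul, skewFun_mul, add_smul, smul_mul_smul_comm]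
  have h := key (comulHom x) (comulHom y)
  rw [← map_mul] at h
  refine h.trans ?_
  congr 2
  exact DFunLike.congr_fun translR_counit x

theorem translR_kleinChar_gen (k i j : Fin 3) :
    translR (kleinChar k) (gen i j) = ((kleinSign k j : ℤ) : PolSOm3) * gen i j := by
  simp only [translR_gen, kleinChar_gen, ite_smul, zero_smul, Finset.sum_ite_eq', Finset.mem_univ,
    if_true, Int.cast_smul_eq_zsmul, zsmul_eq_mul]

theorem translR_kleinChar_comp {i j k : Fin 3} (hij : i ≠ j) (hik : i ≠ k) (hjk : j ≠ k)
    (x : PolSOm3) : translR (kleinChar i) (translR (kleinChar j) x) = translR (kleinChar k) x := by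
  rw [← AlgHom.comp_apply]
  congr 1
  ext a b
  have h : ∀ i j k, i ≠ j → i ≠ k → j ≠ k → ∀ b,
    (kleinSign j b : ℤ) * (kleinSign i b : ℤ) = (kleinSign k b : ℤ) := by decide
  rw [AlgHom.comp_apply, translR_kleinChar_gen, map_mul, map_intCast, translR_kleinChar_gen,
    translR_kleinChar_gen, ← mul_assoc, ← Int.cast_mul, h i j k hij hik hjk]

theorem skewDer_intCast_mul (k : Fin 3) (n : ℤ) (x : PolSOm3) :
    skewDer k (n * x) = n * skewDer k x := by
  rw [← zsmul_eq_mul, map_zsmul, zsmul_eq_mul]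

/-- `skewMat i` exchanges the index `j` with the third index, and χ_j has opposite signs there. -/
theorem skewDer_translR {i j : Fin 3} (hij : i ≠ j) (x : PolSOm3) :
    skewDer i (translR (kleinChar j) x) = -translR (kleinChar j) (skewDer i x) := by
  induction x using induction with
  | hs r => rw [AlgHom.commutes, skewDer_algebraMap, map_zero, neg_zero]
  | hg a b =>
    rw [translR_kleinChar_gen, skewDer_intCast_mul, skewDer_gen, map_sum, Finset.mul_sum,
      ← Finset.sum_neg_distrib]
    refine Finset.sum_congr rfl fun l _ => ?_
    have h : ∀ i j, i ≠ j → ∀ l b, (kleinSign j b : ℤ) * skewMat i l b =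
      -(skewMat i l b * (kleinSign j l : ℤ)) := by decide
    rw [map_mul, map_intCast, translR_kleinChar_gen, ← mul_assoc, ← mul_assoc, ← Int.cast_mul,
      ← Int.cast_mul, h i j hij, Int.cast_neg, neg_mul]
  | hm x y hx hy =>
    obtain ⟨k, hik, hjk⟩ : ∃ k, i ≠ k ∧ j ≠ k := by clear hx hy; revert i j; decide
    rw [map_mul, skewDer_mul, hx, hy, skewDer_mul, translR_kleinChar_comp hij hik hjk, map_add,
      map_mul, map_mul, translR_kleinChar_comp hij.symm hjk hik]
    noncomm_ring
  | ha x y hx hy => simp only [map_add, hx, hy]; abel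

/-- This is the twisted bracket of so(3). On products the mixed terms cancel by `skewDer_translR`.
Its use lies in being inhomogeneous: scaling all derivations by α scales the two sides by α² and α.
-/
theorem skewDer_anticommutator {i j k : Fin 3} (hij : i ≠ j) (hik : i ≠ k) (hjk : j ≠ k)
    (x : PolSOm3) : skewDer i (skewDer j x) + skewDer j (skewDer i x) = skewDer k x := by
  induction x using induction with
  | hs r => simp only [skewDer_algebraMap, map_zero, add_zero]
  | hg a b =>
    have h : ∀ i j k, i ≠ j → i ≠ k → j ≠ k → ∀ b m, ∑ l, (skewMat j l b * skewMat i m l +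
      skewMat i l b * skewMat j m l) = skewMat k m b := by decide
    simp only [skewDer_gen, map_sum, skewDer_intCast_mul, Finset.mul_sum, ← mul_assoc,
      ← Int.cast_mul]
    rw [Finset.sum_comm, Finset.sum_comm (f := fun l m => ((skewMat i l b * skewMat j m l : ℤ) :
      PolSOm3) * gen a m), ← Finset.sum_add_distrib]
    refine Finset.sum_congr rfl fun m _ => ?_
    rw [← Finset.sum_add_distrib, ← h i j k hij hik hjk, Int.cast_sum, Finset.sum_mul]
    simp only [Int.cast_add, add_mul]
  | hm x y hx hy =>
    rw [skewDer_mul, skewDer_mul, skewDer_mul, map_add, map_add, skewDer_mul, skewDer_mul,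
      skewDer_mul, skewDer_mul, skewDer_translR hij, skewDer_translR hij.symm,
      translR_kleinChar_comp hij hik hjk, translR_kleinChar_comp hij.symm hjk hik, ← hx, ← hy]
    noncomm_ring
  | ha x y hx hy => simp only [map_add, ← hx, ← hy]; abel

end PolSOm3

/-! ### Taylor expansion along one-parameter groups. -/

/-- Every higher derivative of `f` lies in `F`, so the Taylor series of the entire function `f` at 0
is zero. -/
theorem eq_zero_of_forall_deriv_mem (F : Submodule ℂ (ℂ → ℂ)) (hd : ∀ f ∈ F, Differentiable ℂ f)
    (hF : ∀ f ∈ F, deriv f ∈ F) (h0 : ∀ f ∈ F, f 0 = 0) (f : ℂ → ℂ) (hf : f ∈ F) : f = 0 := by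
  have h1 : ∀ n, ∀ f ∈ F, iteratedDeriv n f 0 = 0 := by
    intro n
    induction n with
    | zero => simpa using h0
    | succ n ih =>
      intro f hf
      rw [iteratedDeriv_succ']
      exact ih _ (hF f hf)
  have h2 : AnalyticAt ℂ f 0 := (hd f hf).analyticAt 0
  have h3 : analyticOrderAt f 0 = ⊤ := by
    rw [ENat.eq_top_iff_forall_ge]
    exact fun n => (natCast_le_analyticOrderAt_iff_iteratedDeriv_eq_zero h2).2 fun i _ => h1 i f hf
  exact AnalyticOnNhd.eq_of_eventuallyEq (fun z _ => (hd f hf).analyticAt z)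
    (fun z _ => analyticAt_const) (analyticOrderAt_eq_top.1 h3)

theorem intKron_zsmul {B : Type*} [Ring B] (n : ℤ) (Z : Matrix (Fin 4) (Fin 4) ℤ) (b : B) :
    intKron (n • Z) b = n • intKron Z b := by
  ext c d
  rw [Matrix.smul_apply, intKron_apply, intKron_apply, Matrix.smul_apply, zsmul_eq_mul,
    zsmul_eq_mul, Int.cast_mul, mul_assoc]
  rfl

/-- The Levi-Civita symbol. -/
def leviCivita (k l j : Fin 3) : ℤ := ((l : ℤ) - k) * ((j : ℤ) - k) * ((j : ℤ) - l) / 2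

/-- Since e_k e_l = ± e_j for distinct indices, right multiplication by e_k converts the symmetric
matrices of the twisted tangent space into the antisymmetric ones of so(3). -/
theorem skewMat_smul_quatMat_mul_quatRight : ∀ i j k l : Fin 3,
    skewMat k l j • (quatMat i l * quatRight k) = leviCivita k l j • quatMat i j := by decide

theorem quatMat_mul_quatRight : ∀ i j k : Fin 3, quatRight k * quatMat i j =
    (kleinSign k j : ℤ) • (quatMat i j * quatRight k) := by decide

/-- The curve `s ↦ exp (s v)` in the unit quaternions. -/
noncomputable def expCurve (v : Fin 3 → ℂ) (s : ℂ) : Fin 4 → ℂ :=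
  ![Complex.cos s, Complex.sin s * v 0, Complex.sin s * v 1, Complex.sin s * v 2]

theorem expCurve_sq {v : Fin 3 → ℂ} (hv : ∑ k, v k ^ 2 = 1) (s : ℂ) :
    ∑ a, expCurve v s a ^ 2 = 1 := by
  rw [Fin.sum_univ_three] at hv
  rw [Fin.sum_univ_four]
  simp only [expCurve, Matrix.cons_val]
  linear_combination Complex.sin s ^ 2 * hv + Complex.sin_sq_add_cos_sq s

/-- The product of the quaternion `q` and the imaginary quaternion `v`. -/
def quatMulIm (q : Fin 4 → ℂ) (v : Fin 3 → ℂ) : Fin 4 → ℂ :=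
  ![-(v 0 * q 1) - v 1 * q 2 - v 2 * q 3, v 0 * q 0 - v 1 * q 3 + v 2 * q 2,
    v 0 * q 3 + v 1 * q 0 - v 2 * q 1, -(v 0 * q 2) + v 1 * q 1 + v 2 * q 0]

theorem hasDerivAt_expCurve {v : Fin 3 → ℂ} (hv : ∑ k, v k ^ 2 = 1) (s : ℂ) (a : Fin 4) :
    HasDerivAt (fun s => expCurve v s a) (quatMulIm (expCurve v s) v a) s := by
  rw [Fin.sum_univ_three] at hv
  fin_cases a
  · refine (Complex.hasDerivAt_cos s).congr_deriv ?_
    simp [quatMulIm, expCurve]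
    linear_combination Complex.sin s * hv
  · refine ((Complex.hasDerivAt_sin s).mul_const (v 0)).congr_deriv ?_
    simp [quatMulIm, expCurve]
    ring1
  · refine ((Complex.hasDerivAt_sin s).mul_const (v 1)).congr_deriv ?_
    simp [quatMulIm, expCurve]
    ring1
  · refine ((Complex.hasDerivAt_sin s).mul_const (v 2)).congr_deriv ?_
    simp [quatMulIm, expCurve]
    ring1

/-- To first order the rotation of q(1 + tv) is R(q)(1 + 2t v×). The 2 comes from the double cover,
the minus sign from the index order in the Levi-Civita symbol. -/
theorem quatMulIm_bilinear (q : Fin 4 → ℂ) (v : Fin 3 → ℂ) (i j : Fin 3) :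
    ∑ b, ∑ c, (quatMat i j b c : ℂ) * (quatMulIm q v b * q c + q b * quatMulIm q v c) =
      -2 * ∑ k, v k * ∑ l, leviCivita k l j * quatRotation q i l := by
  refine (sum_quatMat_mul (Matrix.of fun b c => quatMulIm q v b * q c + q b * quatMulIm q v c)
    i j).trans ?_
  have h : ∀ k l j, leviCivita k l j = if k = 0 ∧ l = 1 ∧ j = 2 ∨ k = 1 ∧ l = 2 ∧ j = 0 ∨
    k = 2 ∧ l = 0 ∧ j = 1 then 1 else if k = 0 ∧ l = 2 ∧ j = 1 ∨ k = 2 ∧ l = 1 ∧ j = 0 ∨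
    k = 1 ∧ l = 0 ∧ j = 2 then -1 else 0 := by decide
  rw [quatRotation_eq]
  simp only [h, Fin.sum_univ_three, Matrix.of_apply]
  fin_cases i <;> fin_cases j <;> simp <;> simp [quatMulIm] <;> ring1

namespace PolSOm3

/-- The family of representations along the curve `expCurve v`. -/
noncomputable def curveRep {v : Fin 3 → ℂ} (hv : ∑ k, v k ^ 2 = 1) (s : ℂ) :
    PolSOm3 →ₐ[ℂ] Matrix (Fin 4) (Fin 4) ℂ :=
  twistRep (quatRotation (expCurve v s)) (quatRotation_mul_transpose (expCurve_sq hv s))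
    (quatRotation_det (expCurve_sq hv s))

variable {v : Fin 3 → ℂ} (hv : ∑ k, v k ^ 2 = 1)

theorem curveRep_gen (s : ℂ) (i j : Fin 3) :
    curveRep hv s (gen i j) = intKron (quatMat i j) (quatRotation (expCurve v s) i j) :=
  twistRep_gen _ _ _ i j

/-- Conjugation by right multiplication by e_k implements translation by χ_k; this matches the skew
Leibniz rule with the ordinary one for d/ds. -/
theorem quatRight_mul_curveRep (k : Fin 3) (s : ℂ) (y : PolSOm3) :
    intKron (quatRight k) 1 * curveRep hv s y =
      curveRep hv s (translR (kleinChar k) y) * intKron (quatRight k) 1 := by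
  induction y using induction with
  | hs r => simp only [AlgHom.commutes, Algebra.commutes]
  | hg i j =>
    rw [translR_kleinChar_gen, map_mul, map_intCast, curveRep_gen, mul_assoc, intKron_mul,
      intKron_mul, quatMat_mul_quatRight, one_mul, mul_one, intKron_zsmul, zsmul_eq_mul]
  | hm x y hx hy => rw [map_mul, ← mul_assoc, hx, mul_assoc, hy, ← mul_assoc, map_mul, map_mul]
  | ha x y hx hy => rw [map_add, mul_add, hx, hy, map_add, map_add, add_mul]

/-- The derivative of a representation along the curve is given by the skew derivations. -/
theorem hasDerivAt_curveRep (s : ℂ) (y : PolSOm3) (c d : Fin 4) :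
    HasDerivAt (fun s => curveRep hv s y c d)
      (((-2 : ℂ) • ∑ k, v k • (curveRep hv s (skewDer k y) * intKron (quatRight k) 1) :
        Matrix (Fin 4) (Fin 4) ℂ) c d) s := by
  induction y using induction generalizing c d with
  | hs r =>
    simp only [AlgHom.commutes, skewDer_algebraMap, map_zero, zero_mul, smul_zero,
      Finset.sum_const_zero]
    exact hasDerivAt_const _ _
  | hg i j =>
    simp only [curveRep_gen, intKron_apply]
    have h1 : HasDerivAt (fun s => quatRotation (expCurve v s) i j)
        (∑ b, ∑ c, (quatMat i j b c : ℂ) * (quatMulIm (expCurve v s) v b * expCurve v s c +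
          expCurve v s b * quatMulIm (expCurve v s) v c)) s := by
      simp only [quatRotation, Matrix.of_apply]
      refine HasDerivAt.fun_sum fun b _ => HasDerivAt.fun_sum fun c _ => ?_
      exact ((hasDerivAt_expCurve hv s b).mul (hasDerivAt_expCurve hv s c)).const_mul _
    refine (h1.const_mul (quatMat i j c d : ℂ)).congr_deriv ?_
    rw [quatMulIm_bilinear, Matrix.smul_apply, smul_eq_mul, mul_left_comm, Matrix.sum_apply,
      Finset.mul_sum]
    congr 1
    refine Finset.sum_congr rfl fun k _ => ?_
    rw [Matrix.smul_apply, smul_eq_mul, mul_left_comm, skewDer_gen, map_sum, Finset.sum_mul,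
      Matrix.sum_apply, Finset.mul_sum]
    congr 1
    refine Finset.sum_congr rfl fun l _ => ?_
    have h2 : curveRep hv s ((skewMat k l j : PolSOm3) * gen i l) * intKron (quatRight k) 1 =
        leviCivita k l j • intKron (quatMat i j) (quatRotation (expCurve v s) i l) := by
      rw [map_mul, map_intCast, curveRep_gen, mul_assoc, intKron_mul, mul_one, ← zsmul_eq_mul,
        ← intKron_zsmul, skewMat_smul_quatMat_mul_quatRight, intKron_zsmul]
    rw [h2, Matrix.smul_apply, zsmul_eq_mul, intKron_apply, mul_left_comm]
  | hm x y hx hy =>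
    have h1 : HasDerivAt (fun s => ∑ e, curveRep hv s x c e * curveRep hv s y e d) _ s :=
      HasDerivAt.fun_sum fun e _ => (hx c e).mul (hy e d)
    simp only [map_mul, Matrix.mul_apply]
    refine h1.congr_deriv ?_
    rw [Finset.sum_add_distrib, ← Matrix.mul_apply, ← Matrix.mul_apply, ← Matrix.add_apply]
    refine congrFun (congrFun ?_ c) d
    rw [Matrix.smul_mul, Matrix.mul_smul, ← smul_add, Finset.sum_mul, Finset.mul_sum,
      ← Finset.sum_add_distrib]
    congr 1
    refine Finset.sum_congr rfl fun k _ => ?_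
    rw [Matrix.smul_mul, Matrix.mul_smul, ← smul_add, skewDer_mul, map_add, map_mul, map_mul,
      mul_assoc, quatRight_mul_curveRep, add_mul, mul_assoc, mul_assoc, add_comm]
  | ha x y hx hy =>
    simp only [map_add, Matrix.add_apply]
    refine ((hx c d).add (hy c d)).congr_deriv ?_
    rw [← Matrix.add_apply, ← smul_add, ← Finset.sum_add_distrib]
    simp only [← smul_add, add_mul]

/-- At s = 0 the rotation is the identity and only the diagonal matrices `quatMat i i` remain, so
the representation splits into ε and the three χ_k. -/
theorem curveRep_zero (y : PolSOm3) (h0 : counitHom y = 0) (h : ∀ k, kleinChar k y = 0) :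
    curveRep hv 0 y = 0 := by
  have h1 : ∀ y, curveRep hv 0 y = Matrix.diagonal
      ![counitHom y, kleinChar 0 y, kleinChar 1 y, kleinChar 2 y] := by
    intro y
    induction y using induction with
    | hs r =>
      simp only [AlgHom.commutes]
      ext a b
      fin_cases a <;> fin_cases b <;> simp [Matrix.algebraMap_matrix_apply]
    | hg i j =>
      have h2 : quatRotation (expCurve v 0) = 1 := by
        rw [quatRotation_eq]
        ext a b
        fin_cases a <;> fin_cases b <;> simp [expCurve]
      have h3 : ∀ i, quatMat i i = Matrix.diagonal fun a => quatMat i i a a := by decide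
      have h4 : ∀ i, quatMat i i 0 0 = 1 ∧ quatMat i i 1 1 = kleinSign 0 i ∧
        quatMat i i 2 2 = kleinSign 1 i ∧ quatMat i i 3 3 = kleinSign 2 i := by decide
      rw [curveRep_gen, h2]
      by_cases hij : i = j
      · subst hij
        ext a b
        simp only [intKron_apply, kleinChar_gen, counitHom_gen, if_true, Matrix.one_apply]
        by_cases hab : a = b
        · subst hab
          fin_cases a <;> simp [h4]
        · rw [h3, Matrix.diagonal_apply_ne _ hab]
          simp [hab]
      · ext a b
        simp only [intKron_apply, kleinChar_gen, counitHom_gen, if_neg hij, Matrix.one_apply]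
        fin_cases a <;> fin_cases b <;> simp
    | hm x y hx hy =>
      rw [map_mul, hx, hy, Matrix.diagonal_mul_diagonal]
      congr 1
      ext a
      fin_cases a <;> simp
    | ha x y hx hy =>
      rw [map_add, hx, hy, Matrix.diagonal_add]
      congr 1
      ext a
      fin_cases a <;> simp
  rw [h1, h0, h, h, h]
  ext a b
  fin_cases a <;> fin_cases b <;> simp

/-- The skew derivations and the diagonal characters separate the points. -/
theorem eq_zero_of_mem_of_skewDer_mem (W : Submodule ℂ PolSOm3)
    (hW : ∀ k, ∀ y ∈ W, skewDer k y ∈ W) (h0 : ∀ y ∈ W, counitHom y = 0)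
    (h : ∀ k, ∀ y ∈ W, kleinChar k y = 0) (y : PolSOm3) (hy : y ∈ W) : y = 0 := by
  have key : ∀ {v : Fin 3 → ℂ} (hv : ∑ k, v k ^ 2 = 1) (s : ℂ), curveRep hv s y = 0 := by
    intro v hv s
    ext c d
    -- The matrix coefficients of all of `W` are needed, because differentiating those of `y`
    -- produces coefficients of the `skewDer k y`.
    set F : Submodule ℂ (ℂ → ℂ) := Submodule.span ℂ
      {f | ∃ y ∈ W, ∃ c d, f = fun s => curveRep hv s y c d} with hF
    have hgen : ∀ y ∈ W, ∀ c d, (fun s => curveRep hv s y c d) ∈ F := fun y hy c d =>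
      Submodule.subset_span ⟨y, hy, c, d, rfl⟩
    have hall : ∀ f ∈ F, Differentiable ℂ f ∧ deriv f ∈ F ∧ f 0 = 0 := by
      intro f hf
      induction hf using Submodule.span_induction with
      | mem f hf =>
        obtain ⟨y, hy, c, d, rfl⟩ := hf
        refine ⟨fun s => (hasDerivAt_curveRep hv s y c d).differentiableAt, ?_, ?_⟩
        · have h1 : (deriv fun s => curveRep hv s y c d) = (-2 : ℂ) • ∑ k, v k • ∑ e,
              ((quatRight k e d : ℤ) : ℂ) • fun s => curveRep hv s (skewDer k y) c e := by
            ext s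
            rw [(hasDerivAt_curveRep hv s y c d).deriv]
            simp only [Matrix.smul_apply, Matrix.sum_apply, Matrix.mul_apply, intKron_apply,
              Pi.smul_apply, Finset.sum_apply, smul_eq_mul, mul_one]
            simp only [mul_comm ((quatRight _ _ _ : ℤ) : ℂ)]
          rw [h1]
          exact F.smul_mem _ (F.sum_mem fun k _ => F.smul_mem _ (F.sum_mem fun e _ =>
            F.smul_mem _ (hgen _ (hW k y hy) c e)))
        · simp only [curveRep_zero hv y (h0 y hy) fun k => h k y hy, Matrix.zero_apply]
      | zero =>
        refine ⟨differentiable_const 0, ?_, rfl⟩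
        rw [show deriv (0 : ℂ → ℂ) = 0 from funext fun s => deriv_const s 0]
        exact F.zero_mem
      | add f g _ _ hf hg =>
        refine ⟨hf.1.add hg.1, ?_, by rw [Pi.add_apply, hf.2.2, hg.2.2, add_zero]⟩
        rw [show deriv (f + g) = deriv f + deriv g from
          funext fun s => deriv_add (hf.1 s) (hg.1 s)]
        exact F.add_mem hf.2.1 hg.2.1
      | smul r f _ hf =>
        refine ⟨hf.1.const_smul r, ?_, by rw [Pi.smul_apply, hf.2.2, smul_zero]⟩
        rw [show deriv (r • f) = r • deriv f from
          funext fun s => deriv_const_smul r (hf.1 s)]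
        exact F.smul_mem r hf.2.1
    exact congrFun (eq_zero_of_forall_deriv_mem F (fun f hf => (hall f hf).1)
      (fun f hf => (hall f hf).2.1) (fun f hf => (hall f hf).2.2) _ (hgen y hy c d)) s
  refine eq_zero_of_twistRep_quatRotation y fun q hq him hne => ?_
  -- Polar form q = exp(sv): take cos s = q_0 and v the imaginary part divided by sin s, which is
  -- nonzero because q is real with nonzero imaginary part.
  obtain ⟨s, hs⟩ := Complex.cos_surjective (q 0)
  have hsin : Complex.sin s ^ 2 = q 1 ^ 2 + q 2 ^ 2 + q 3 ^ 2 := by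
    rw [Fin.sum_univ_four] at hq
    linear_combination Complex.sin_sq_add_cos_sq s - hq - (Complex.cos s + q 0) * hs
  have hre : ∀ a, q a = ((q a).re : ℂ) := fun a => Complex.ext rfl (by simp [him a])
  have hsin0 : Complex.sin s ≠ 0 := by
    intro h1
    rw [h1, hre 1, hre 2, hre 3] at hsin
    have h2 : (q 1).re ^ 2 + (q 2).re ^ 2 + (q 3).re ^ 2 = 0 := by
      apply Complex.ofReal_injective
      push_cast
      rw [← hsin]
      simp
    obtain ⟨a, ha0, ha⟩ := hne
    have h3 : (q 1).re = 0 ∧ (q 2).re = 0 ∧ (q 3).re = 0 := by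
      refine ⟨?_, ?_, ?_⟩ <;> nlinarith [sq_nonneg (q 1).re, sq_nonneg (q 2).re, sq_nonneg (q 3).re]
    apply ha
    rw [hre a]
    fin_cases a
    · exact absurd rfl ha0
    · simp [h3.1]
    · simp [h3.2.1]
    · simp [h3.2.2]
  have hv : ∑ k, (fun k : Fin 3 => q k.succ / Complex.sin s) k ^ 2 = 1 := by
    rw [Fin.sum_univ_three]
    simp only [div_pow]
    rw [← add_div, ← add_div, div_eq_one_iff_eq (pow_ne_zero 2 hsin0), hsin]
    rfl
  have hq2 : q = expCurve (fun k : Fin 3 => q k.succ / Complex.sin s) s := by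
    ext a
    fin_cases a
    · exact hs.symm
    all_goals
      simp [expCurve]
      field_simp
      try rfl
  have h4 := key hv s
  unfold curveRep at h4
  convert h4 using 3
  exact congrArg quatRotation hq2

end PolSOm3

/-! ### Conjugation by signed permutation matrices. -/

namespace SOm3Relations

variable {B : Type*} [Ring B] {u : Matrix (Fin 3) (Fin 3) B}

theorem submatrix (hu : SOm3Relations u) (p : Equiv.Perm (Fin 3)) :
    SOm3Relations (u.submatrix p p) where
  mul_transpose := by
    rw [Matrix.transpose_submatrix, Matrix.submatrix_mul_equiv, hu.mul_transpose,
      Matrix.submatrix_one_equiv]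
  transpose_mul := by
    rw [Matrix.transpose_submatrix, Matrix.submatrix_mul_equiv, hu.transpose_mul,
      Matrix.submatrix_one_equiv]
  anticomm_row i j k h := hu.anticomm_row _ _ _ (p.injective.ne h)
  anticomm_col i j k h := hu.anticomm_col _ _ _ (p.injective.ne h)
  comm i j k l h h' := hu.comm _ _ _ _ (p.injective.ne h) (p.injective.ne h')
  perm_eq_one := by
    have h := hu.perm_rows (p 0) (p 1) (p 2)
    rw [if_pos ⟨p.injective.ne (by decide), p.injective.ne (by decide),
      p.injective.ne (by decide)⟩, ← Equiv.sum_comp (Equiv.mulLeft p)] at h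
    exact h

theorem signs (hu : SOm3Relations u) (e : Fin 3 → ℤˣ) :
    SOm3Relations (Matrix.of fun i j => ((e i * e j : ℤˣ) : ℤ) • u i j) where
  mul_transpose := by
    ext i j
    have h := congrFun (congrFun hu.mul_transpose i) j
    rw [Matrix.mul_apply] at h ⊢
    simp only [Matrix.transpose_apply, Matrix.of_apply, smul_mul_smul_comm] at h ⊢
    have h1 : ∀ k, ((e i * e k : ℤˣ) : ℤ) * ((e j * e k : ℤˣ) : ℤ) = ((e i * e j : ℤˣ) : ℤ) := by
      intro k
      rw [← Units.val_mul, mul_mul_mul_comm, Int.units_mul_self, mul_one]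
    simp only [h1, ← Finset.smul_sum, h]
    by_cases hij : i = j
    · subst hij
      simp
    · simp [hij]
  transpose_mul := by
    ext i j
    have h := congrFun (congrFun hu.transpose_mul i) j
    rw [Matrix.mul_apply] at h ⊢
    simp only [Matrix.transpose_apply, Matrix.of_apply, smul_mul_smul_comm] at h ⊢
    have h1 : ∀ k, ((e k * e i : ℤˣ) : ℤ) * ((e k * e j : ℤˣ) : ℤ) = ((e i * e j : ℤˣ) : ℤ) := by
      intro k
      rw [← Units.val_mul, mul_mul_mul_comm, Int.units_mul_self, one_mul]
    simp only [h1, ← Finset.smul_sum, h]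
    by_cases hij : i = j
    · subst hij
      simp
    · simp [hij]
  anticomm_row i j k h := by
    simp only [Matrix.of_apply, smul_mul_smul_comm]
    rw [hu.anticomm_row i j k h, smul_neg, mul_comm ((e i * e j : ℤˣ) : ℤ)]
  anticomm_col i j k h := by
    simp only [Matrix.of_apply, smul_mul_smul_comm]
    rw [hu.anticomm_col i j k h, smul_neg, mul_comm ((e i * e j : ℤˣ) : ℤ)]
  comm i j k l h h' := by
    simp only [Matrix.of_apply, smul_mul_smul_comm]
    rw [hu.comm i j k l h h', mul_comm ((e i * e j : ℤˣ) : ℤ)]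
  perm_eq_one := by
    rw [← hu.perm_eq_one]
    refine Finset.sum_congr rfl fun σ _ => ?_
    have h : e 0 * e (σ 0) * (e 1 * e (σ 1)) * (e 2 * e (σ 2)) = 1 := by
      have h1 : e (σ 0) * e (σ 1) * e (σ 2) = e 0 * e 1 * e 2 := by
        rw [← Fin.prod_univ_three e, ← Fin.prod_univ_three fun i => e (σ i)]
        exact Equiv.prod_comp σ e
      calc e 0 * e (σ 0) * (e 1 * e (σ 1)) * (e 2 * e (σ 2))
          = (e 0 * e 1 * e 2) * (e (σ 0) * e (σ 1) * e (σ 2)) := by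
            simp only [mul_assoc, mul_left_comm, mul_comm]
        _ = 1 := by rw [h1, Int.units_mul_self]
    simp only [Matrix.of_apply, smul_mul_smul_comm]
    rw [← Units.val_mul, ← Units.val_mul, h, Units.val_one, one_smul]

end SOm3Relations

theorem exists_stdRepMatrix_eq (x : Equiv.Perm (Fin 4)) : ∃ (p : Equiv.Perm (Fin 3))
    (e : Fin 3 → ℤˣ), e 0 * e 1 * e 2 = 1 ∧
      stdRepMatrix x = (signedPerm p e).map (Int.castRingHom ℝ) := by
  obtain ⟨p, e, he, h⟩ := intBasis_signedPerm x
  refine ⟨p, e, he, ?_⟩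
  ext i j
  have h1 := stdRepMatrix_apply x i j
  rw [h, Int.cast_mul, Int.cast_ofNat] at h1
  simpa [signedPerm] using mul_left_cancel₀ four_ne_zero h1

theorem exists_signedPerm_eq (p : Equiv.Perm (Fin 3)) (e : Fin 3 → ℤˣ) (he : e 0 * e 1 * e 2 = 1) :
    ∃ x, stdRepMatrix x = (signedPerm p e).map (Int.castRingHom ℝ) := by
  obtain ⟨x, h⟩ := exists_intBasis_signedPerm p e he
  refine ⟨x, ?_⟩
  ext i j
  have h1 := stdRepMatrix_apply x i j
  rw [h, Int.cast_mul, Int.cast_ofNat] at h1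
  simpa [signedPerm] using mul_left_cancel₀ four_ne_zero h1

theorem stdRepMatrix_injective : Function.Injective stdRepMatrix := by
  intro x y h
  have h1 : stdRepMatrix (y⁻¹ * x) = 1 := by
    rw [stdRepMatrix_mul, h, ← stdRepMatrix_mul, inv_mul_cancel, stdRepMatrix_one]
  refine (inv_mul_eq_one.1 (intBasis_faithful _ fun i j => ?_)).symm
  have h2 := stdRepMatrix_apply (y⁻¹ * x) i j
  rw [h1, Matrix.one_apply] at h2
  exact_mod_cast h2.symm

namespace PolSOm3

theorem scalarMatrix_mul (F G : Matrix (Fin 3) (Fin 3) ℝ) :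
    scalarMatrix (F * G) = scalarMatrix F * scalarMatrix G := by
  ext i j
  simp [scalarMatrix, Matrix.mul_apply]

theorem scalarMatrix_transpose_mul (F G : Matrix (Fin 3) (Fin 3) ℝ) :
    (scalarMatrix (F * G))ᵀ = (scalarMatrix G)ᵀ * (scalarMatrix F)ᵀ := by
  have h : ∀ F, (scalarMatrix F)ᵀ = scalarMatrix Fᵀ := fun F => rfl
  rw [h, h, h, Matrix.transpose_mul, scalarMatrix_mul]

theorem scalarMatrix_conj_apply {x : Equiv.Perm (Fin 4)} {p : Equiv.Perm (Fin 3)} {e : Fin 3 → ℤˣ}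
    (h : stdRepMatrix x = (signedPerm p e).map (Int.castRingHom ℝ)) (i j : Fin 3) :
    ((scalarMatrix (stdRepMatrix x))ᵀ * gen * scalarMatrix (stdRepMatrix x)) i j =
      ((e i * e j : ℤˣ) : ℤ) • gen (p i) (p j) := by
  have h1 : ∀ k j, scalarMatrix (stdRepMatrix x) k j = if k = p j then ((e j : ℤ) : PolSOm3) else 0 := by
    intro k j
    rw [h]
    simp only [scalarMatrix, signedPerm, Matrix.map_apply, Matrix.of_apply]
    split_ifs <;> simp
  simp only [Matrix.mul_apply, Matrix.transpose_apply, h1, ite_mul, zero_mul, mul_ite, mul_zero,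
    Finset.sum_ite_eq', Finset.mem_univ, if_true]
  rw [mul_assoc, ← (Int.cast_commute (e j : ℤ) (gen (p i) (p j))).eq, ← mul_assoc, ← Int.cast_mul,
    ← Units.val_mul, zsmul_eq_mul]

theorem relations_conj (x : Equiv.Perm (Fin 4)) :
    SOm3Relations ((scalarMatrix (stdRepMatrix x))ᵀ * gen * scalarMatrix (stdRepMatrix x)) := by
  obtain ⟨p, e, _, h⟩ := exists_stdRepMatrix_eq x
  convert (relations_gen.submatrix p).signs e using 1
  ext i j
  exact scalarMatrix_conj_apply h i j

/-- The endomorphism `A ↦ ρ(x)ᵀ A ρ(x)`. -/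
noncomputable def conjHom (x : Equiv.Perm (Fin 4)) : PolSOm3 →ₐ[ℂ] PolSOm3 :=
  lift _ (relations_conj x)

theorem conjHom_gen (x : Equiv.Perm (Fin 4)) (i j : Fin 3) : conjHom x (gen i j) =
    ((scalarMatrix (stdRepMatrix x))ᵀ * gen * scalarMatrix (stdRepMatrix x)) i j :=
  lift_gen _ _ i j

theorem map_scalarMatrix_conj {B : Type*} [Ring B] [Algebra ℂ B] (f : PolSOm3 →ₐ[ℂ] B)
    (F : Matrix (Fin 3) (Fin 3) ℝ) :
    ((scalarMatrix F)ᵀ * gen * scalarMatrix F).map f =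
      (F.map fun t : ℝ => algebraMap ℂ B t)ᵀ * gen.map f * F.map fun t : ℝ => algebraMap ℂ B t := by
  ext i j
  simp [Matrix.mul_apply, scalarMatrix]

/-- Scalars are fixed by `conjHom x`, so it acts inside ρ(y)ᵀ A ρ(y) and yields ρ(y)ᵀ ρ(x)ᵀ A ρ(x)
ρ(y); hence the order of the product is preserved. -/
theorem conjHom_mul (x y : Equiv.Perm (Fin 4)) :
    conjHom (x * y) = (conjHom x).comp (conjHom y) := by
  ext i j
  have h : (gen.map (conjHom x)) =
      (scalarMatrix (stdRepMatrix x))ᵀ * gen * scalarMatrix (stdRepMatrix x) := by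
    ext i j
    exact conjHom_gen x i j
  have h1 := congrFun (congrFun (map_scalarMatrix_conj (conjHom x) (stdRepMatrix y)) i) j
  rw [AlgHom.comp_apply, conjHom_gen, conjHom_gen]
  rw [Matrix.map_apply] at h1
  rw [h1, h, stdRepMatrix_mul, scalarMatrix_mul, ← scalarMatrix_mul, scalarMatrix_transpose_mul,
    scalarMatrix_mul]
  simp only [Matrix.mul_assoc]
  rfl

theorem conjHom_one : conjHom 1 = AlgHom.id ℂ PolSOm3 := by
  ext i j
  have h : scalarMatrix 1 = 1 := Matrix.map_one _ (by simp) (by simp)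
  rw [conjHom_gen, stdRepMatrix_one, h]
  simp

theorem counitHom_conjHom (x : Equiv.Perm (Fin 4)) (y : PolSOm3) :
    counitHom (conjHom x y) = counitHom y := by
  obtain ⟨p, e, _, h⟩ := exists_stdRepMatrix_eq x
  rw [← AlgHom.comp_apply]
  congr 1
  ext i j
  rw [AlgHom.comp_apply, conjHom_gen, scalarMatrix_conj_apply h, map_zsmul, counitHom_gen,
    counitHom_gen]
  by_cases hij : i = j
  · subst hij
    simp
  · simp [hij]

theorem comulHom_conjHom (x : Equiv.Perm (Fin 4)) (y : PolSOm3) :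
    comulHom (conjHom x y) = Algebra.TensorProduct.map (conjHom x) (conjHom x) (comulHom y) := by
  obtain ⟨p, e, _, h⟩ := exists_stdRepMatrix_eq x
  rw [← AlgHom.comp_apply, ← AlgHom.comp_apply]
  congr 1
  ext i j
  rw [AlgHom.comp_apply, AlgHom.comp_apply, conjHom_gen, scalarMatrix_conj_apply h, map_zsmul,
    comulHom_gen, comulHom_gen, map_sum, ← Equiv.sum_comp p, Finset.smul_sum]
  refine Finset.sum_congr rfl fun k _ => ?_
  rw [Algebra.TensorProduct.map_tmul, conjHom_gen, conjHom_gen, scalarMatrix_conj_apply h,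
    scalarMatrix_conj_apply h, TensorProduct.smul_tmul, TensorProduct.tmul_smul,
    TensorProduct.tmul_smul, smul_smul, ← Units.val_mul]
  congr 2
  rw [mul_mul_mul_comm, mul_comm (e k), mul_mul_mul_comm, Int.units_mul_self, mul_one]

theorem conjHom_star (x : Equiv.Perm (Fin 4)) (y : PolSOm3) :
    conjHom x (star y) = star (conjHom x y) := by
  obtain ⟨p, e, _, h⟩ := exists_stdRepMatrix_eq x
  induction y using induction with
  | hs r => rw [star_algebraMap, AlgHom.commutes, AlgHom.commutes, star_algebraMap]
  | hg i j => rw [star_gen, conjHom_gen, scalarMatrix_conj_apply h, star_zsmul, star_gen]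
  | hm a b ha hb => rw [star_mul, map_mul, map_mul, star_mul, ha, hb]
  | ha a b ha hb => rw [star_add, map_add, map_add, star_add, ha, hb]

/-- The automorphism `A ↦ ρ(x)ᵀ A ρ(x)`. -/
noncomputable def conjAut : Equiv.Perm (Fin 4) →* hopfStarAut PolSOm3 where
  toFun x := ⟨AlgEquiv.ofAlgHom (conjHom x) (conjHom x⁻¹)
      (by rw [← conjHom_mul, mul_inv_cancel, conjHom_one])
      (by rw [← conjHom_mul, inv_mul_cancel, conjHom_one]),
    comulHom_conjHom x, counitHom_conjHom x, conjHom_star x⟩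
  map_one' := Subtype.ext (AlgEquiv.ext fun y => DFunLike.congr_fun conjHom_one y)
  map_mul' x y := Subtype.ext (AlgEquiv.ext fun z => DFunLike.congr_fun (conjHom_mul x y) z)

theorem conjAut_apply (x : Equiv.Perm (Fin 4)) (y : PolSOm3) : (conjAut x).1 y = conjHom x y := rfl

theorem relations_stdRepMatrix (x : Equiv.Perm (Fin 4)) :
    SOm3Relations ((stdRepMatrix x).map Complex.ofRealHom) := by
  obtain ⟨p, e, he, h⟩ := exists_stdRepMatrix_eq x
  rw [h]
  exact ((SOm3Relations.signedPerm p e he).map _).map _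

/-! ### Characters and the group S_4. -/

/-- The character of `Pol(SO_{-1}(3))` given by an element of `S_4`. -/
noncomputable def permChar (x : Equiv.Perm (Fin 4)) : PolSOm3 →ₐ[ℂ] ℂ :=
  lift _ (relations_stdRepMatrix x)

theorem permChar_gen (x : Equiv.Perm (Fin 4)) (i j : Fin 3) :
    permChar x (gen i j) = (stdRepMatrix x i j : ℂ) := lift_gen _ _ i j

theorem permChar_injective : Function.Injective permChar := by
  intro x y h
  apply stdRepMatrix_injective
  ext i j
  have h1 := DFunLike.congr_fun h (gen i j)
  rw [permChar_gen, permChar_gen] at h1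
  exact_mod_cast h1

theorem permChar_eq_signedChar {x : Equiv.Perm (Fin 4)} {p : Equiv.Perm (Fin 3)} {e : Fin 3 → ℤˣ}
    (he : e 0 * e 1 * e 2 = 1) (h : stdRepMatrix x = (signedPerm p e).map (Int.castRingHom ℝ)) :
    permChar x = signedChar p e he := by
  ext i j
  rw [permChar_gen, h, signedChar, lift_gen]
  simp

/-- Every character is given by an element of `S_4`. -/
theorem exists_permChar_eq (χ : PolSOm3 →ₐ[ℂ] ℂ) : ∃ x, χ = permChar x := by
  have hu := relations_gen.map χ.toRingHom
  set u := gen.map χ.toRingHom with hu_def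
  -- Complex numbers that anticommute have product 0, so each row and each column has at most one
  -- nonzero entry.
  have hrow : ∀ i j k, k ≠ j → u i j * u i k = 0 := fun i j k hk => by
    have := hu.anticomm_row i j k hk
    rw [mul_comm (u i k)] at this
    exact self_eq_neg.1 this
  have hcol : ∀ i j k, k ≠ i → u i j * u k j = 0 := fun i j k hk => by
    have := hu.anticomm_col i j k hk
    rw [mul_comm (u k j)] at this
    exact self_eq_neg.1 this
  have hsq : ∀ j, ∑ i, u i j * u i j = 1 := fun j => by
    have := congrFun (congrFun hu.transpose_mul j) j
    simpa [Matrix.mul_apply] using this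
  have hex : ∀ j, ∃ i, u i j ≠ 0 := by
    intro j
    by_contra! h
    simpa [h] using hsq j
  choose p hp using hex
  have hz : ∀ i j, i ≠ p j → u i j = 0 := fun i j hij =>
    (mul_eq_zero.1 (hcol (p j) j i hij)).resolve_left (hp j)
  have hinj : Function.Injective p := by
    intro j k hjk
    by_contra hne
    have h1 := hrow (p j) j k (Ne.symm hne)
    have h2 := hp k
    rw [← hjk] at h2
    exact (mul_ne_zero (hp j) h2) h1
  have hone : ∀ j, ∃ e : ℤˣ, u (p j) j = ((e : ℤ) : ℂ) := by
    intro j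
    have h1 := hsq j
    rw [Finset.sum_eq_single (p j) (fun i _ hi => by rw [hz i j hi, zero_mul])
      (fun h => absurd (Finset.mem_univ _) h)] at h1
    rcases mul_self_eq_one_iff.1 h1 with h2 | h2
    · exact ⟨1, by simpa using h2⟩
    · exact ⟨-1, by simpa using h2⟩
  choose e he using hone
  set σ : Equiv.Perm (Fin 3) := Equiv.ofBijective p (Finite.injective_iff_bijective.1 hinj)
  have hue : u = (signedPerm σ e).map (Int.castRingHom ℂ) := by
    ext i j
    simp only [signedPerm, Matrix.map_apply, Matrix.of_apply]
    by_cases hij : i = σ j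
    · rw [if_pos hij, hij]
      exact he j
    · rw [if_neg hij, map_zero]
      exact hz i j hij
  have hprod : e 0 * e 1 * e 2 = 1 := by
    have h1 : ∀ (p : Equiv.Perm (Fin 3)) (e : Fin 3 → ℤˣ),
      ∑ τ : Equiv.Perm (Fin 3), signedPerm p e 0 (τ 0) * signedPerm p e 1 (τ 1) *
        signedPerm p e 2 (τ 2) = ((e 0 * e 1 * e 2 : ℤˣ) : ℤ) := by decide
    have h2 := hu.perm_eq_one
    rw [hue] at h2
    simp only [Matrix.map_apply, ← map_mul, ← map_sum] at h2
    rw [h1, eq_intCast, Int.cast_eq_one] at h2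
    exact Units.ext h2
  obtain ⟨x, hx⟩ := exists_signedPerm_eq σ e hprod
  refine ⟨x, ?_⟩
  rw [permChar_eq_signedChar hprod hx]
  ext i j
  rw [signedChar, lift_gen, ← hue]
  rfl

/-- The convolution product of characters. -/
noncomputable def convChar (χ ψ : PolSOm3 →ₐ[ℂ] ℂ) : PolSOm3 →ₐ[ℂ] ℂ :=
  ((Algebra.TensorProduct.lid ℂ ℂ).toAlgHom.comp (Algebra.TensorProduct.map χ ψ)).comp comulHom

theorem convChar_gen (χ ψ : PolSOm3 →ₐ[ℂ] ℂ) (i j : Fin 3) :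
    convChar χ ψ (gen i j) = ∑ k, χ (gen i k) * ψ (gen k j) := by
  simp [convChar]

theorem convChar_permChar (x y : Equiv.Perm (Fin 4)) :
    convChar (permChar x) (permChar y) = permChar (x * y) := by
  ext i j
  simp [convChar_gen, permChar_gen, stdRepMatrix_mul, Matrix.mul_apply]

theorem permChar_conjHom (x y : Equiv.Perm (Fin 4)) :
    (permChar y).comp (conjHom x) = permChar (x⁻¹ * y * x) := by
  ext i j
  have h1 := congrFun (congrFun (map_scalarMatrix_conj (permChar y) (stdRepMatrix x)) i) j
  have h2 : gen.map (permChar y) = (stdRepMatrix y).map fun t : ℝ => algebraMap ℂ ℂ t := by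
    ext i j
    simp [permChar_gen]
  rw [Matrix.map_apply, h2] at h1
  rw [AlgHom.comp_apply, conjHom_gen, h1, permChar_gen, stdRepMatrix_mul, stdRepMatrix_mul,
    stdRepMatrix_inv]
  simp [Matrix.mul_apply]

/-- On characters the automorphism of x acts as y ↦ x⁻¹yx, and S_4 has trivial centre. -/
theorem conjAut_injective : Function.Injective conjAut := by
  rw [injective_iff_map_eq_one]
  intro x hx
  have h1 : ∀ y, permChar (x⁻¹ * y * x) = permChar y := by
    intro y
    rw [← permChar_conjHom]
    ext i j
    rw [AlgHom.comp_apply, ← conjAut_apply, hx]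
    rfl
  have h2 : ∀ y, y * x = x * y := by
    intro y
    have h3 := permChar_injective (h1 y)
    rw [mul_assoc, inv_mul_eq_iff_eq_mul] at h3
    exact h3
  have h4 : ∀ x : Equiv.Perm (Fin 4), x * finRotate 4 = finRotate 4 * x →
      x * Equiv.swap 0 1 = Equiv.swap 0 1 * x → x = 1 := by decide
  exact h4 x (h2 _).symm (h2 _).symm

theorem perm_hom_eq_conj (α : Equiv.Perm (Fin 4) →* Equiv.Perm (Fin 4))
    (hα : Function.Injective α) : ∃ z, ∀ y, α y = z * y * z⁻¹ := by
  have hc : (finRotate 4) ^ 4 = 1 ∧ (finRotate 4) ^ 2 ≠ 1 := by decide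
  have hs : (Equiv.swap 0 1 : Equiv.Perm (Fin 4)) ^ 2 = 1 ∧
    (Equiv.swap 0 1 : Equiv.Perm (Fin 4)) ≠ 1 := by decide
  have hsc : ((Equiv.swap 0 1 : Equiv.Perm (Fin 4)) * finRotate 4) ^ 3 = 1 := by decide
  obtain ⟨z, hz1, hz2⟩ := exists_conj_finRotate_swap (α (finRotate 4)) (α (Equiv.swap 0 1))
    ⟨⟨by rw [← map_pow, hc.1, map_one], by rw [← map_pow]; exact (map_ne_one_iff α hα).2 hc.2⟩,
      ⟨by rw [← map_pow, hs.1, map_one], (map_ne_one_iff α hα).2 hs.2⟩,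
      by rw [← map_mul, ← map_pow, hsc, map_one]⟩
  refine ⟨z, fun y => ?_⟩
  have hcl := Equiv.Perm.closure_cycle_adjacent_swap (σ := finRotate 4) isCycle_finRotate
    support_finRotate 0
  have hy : y ∈ Subgroup.closure
      ({finRotate 4, Equiv.swap 0 (finRotate 4 0)} : Set (Equiv.Perm (Fin 4))) := by
    rw [hcl]; trivial
  have := MonoidHom.eqOn_closure (f := α) (g := (MulAut.conj z).toMonoidHom)
    (s := {finRotate 4, Equiv.swap 0 (finRotate 4 0)}) (by
      rintro _ (rfl | rfl)
      · exact eq_mul_inv_of_mul_eq hz1.symm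
      · exact eq_mul_inv_of_mul_eq hz2.symm) hy
  exact this

/-! ### Automorphisms fixing all characters. -/

theorem convChar_comp {θ : PolSOm3 ≃ₐ[ℂ] PolSOm3}
    (hθ : ∀ x, comulHom (θ x) = TensorProduct.map θ.toLinearMap θ.toLinearMap (comulHom x))
    (χ ψ : PolSOm3 →ₐ[ℂ] ℂ) :
    (convChar χ ψ).comp θ.toAlgHom = convChar (χ.comp θ.toAlgHom) (ψ.comp θ.toAlgHom) := by
  ext1 i j
  simp only [AlgHom.comp_apply, convChar]
  have h : ∀ t, Algebra.TensorProduct.map χ ψ (TensorProduct.map θ.toLinearMap θ.toLinearMap t) =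
      Algebra.TensorProduct.map (χ.comp θ.toAlgHom) (ψ.comp θ.toAlgHom) t := by
    intro t
    induction t using TensorProduct.induction_on with
    | zero => simp
    | add t s ht hs => rw [map_add, map_add, ht, hs, map_add]
    | tmul a b => rfl
  rw [← h]
  exact congrArg _ (congrArg _ (hθ _))

theorem transl_apply {θ : PolSOm3 ≃ₐ[ℂ] PolSOm3}
    (hθ : ∀ x, comulHom (θ x) = TensorProduct.map θ.toLinearMap θ.toLinearMap (comulHom x))
    (f : PolSOm3 →ₗ[ℂ] ℂ) (x : PolSOm3) :
    transl f (θ x) = θ (transl (f ∘ₗ θ.toLinearMap) x) := by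
  simp only [transl, LinearMap.comp_apply, AlgHom.toLinearMap_apply, LinearEquiv.coe_coe, hθ]
  generalize comulHom x = t
  induction t using TensorProduct.induction_on with
  | zero => simp
  | add t s ht hs => simp only [map_add, ht, hs]
  | tmul a b => simp

theorem translR_apply {θ : PolSOm3 ≃ₐ[ℂ] PolSOm3}
    (hθ : ∀ x, comulHom (θ x) = TensorProduct.map θ.toLinearMap θ.toLinearMap (comulHom x))
    {χ : PolSOm3 →ₐ[ℂ] ℂ} (hχ : χ.comp θ.toAlgHom = χ) (x : PolSOm3) :
    translR χ (θ x) = θ (translR χ x) := by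
  simp only [translR, AlgHom.comp_apply, hθ]
  generalize comulHom x = t
  induction t using TensorProduct.induction_on with
  | zero => simp
  | add t s ht hs => simp only [map_add, ht, hs]
  | tmul a b =>
    have h : χ (θ b) = χ b := DFunLike.congr_fun hχ b
    simp [h]

theorem translL_apply {θ : PolSOm3 ≃ₐ[ℂ] PolSOm3}
    (hθ : ∀ x, comulHom (θ x) = TensorProduct.map θ.toLinearMap θ.toLinearMap (comulHom x))
    {χ : PolSOm3 →ₐ[ℂ] ℂ} (hχ : χ.comp θ.toAlgHom = χ) (x : PolSOm3) :
    translL χ (θ x) = θ (translL χ x) := by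
  simp only [translL, AlgHom.comp_apply, hθ]
  generalize comulHom x = t
  induction t using TensorProduct.induction_on with
  | zero => simp
  | add t s ht hs => simp only [map_add, ht, hs]
  | tmul a b =>
    have h : χ (θ a) = χ a := DFunLike.congr_fun hχ a
    simp [h]

/-- Consequently a Hopf automorphism fixing all characters commutes with every `conjHom x`. -/
theorem conjHom_eq_transl (x : Equiv.Perm (Fin 4)) :
    conjHom x = (translL (permChar x⁻¹)).comp (translR (permChar x)) := by
  ext i j
  rw [conjHom_gen, AlgHom.comp_apply, translR_gen, map_sum]
  simp only [map_smul, translL_gen, permChar_gen, stdRepMatrix_inv, Matrix.transpose_apply,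
    Matrix.mul_apply, scalarMatrix, Matrix.map_apply]
  refine Finset.sum_congr rfl fun k _ => ?_
  rw [Algebra.smul_def, Algebra.commutes]
  simp only [Algebra.smul_def]

theorem skew_ext {f g : PolSOm3 →ₗ[ℂ] ℂ} (χ : PolSOm3 →ₐ[ℂ] ℂ)
    (hf : ∀ x y, f (x * y) = counitHom x * f y + f x * χ y)
    (hg : ∀ x y, g (x * y) = counitHom x * g y + g x * χ y)
    (h : ∀ i j, f (gen i j) = g (gen i j)) : f = g := by
  have h1 : ∀ f : PolSOm3 →ₗ[ℂ] ℂ, (∀ x y, f (x * y) = counitHom x * f y + f x * χ y) →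
      ∀ r : ℂ, f (algebraMap ℂ PolSOm3 r) = 0 := by
    intro f hf r
    have h2 := hf 1 1
    rw [mul_one, map_one counitHom, map_one χ, one_mul, mul_one] at h2
    rw [Algebra.algebraMap_eq_smul_one, map_smul, left_eq_add.1 h2, smul_zero]
  ext x
  induction x using induction with
  | hs r => rw [h1 f hf, h1 g hg]
  | hg i j => exact h i j
  | hm x y hx hy => rw [hf, hg, hx, hy]
  | ha x y hx hy => rw [map_add, map_add, hx, hy]

theorem exists_conjHom_gen (p : Equiv.Perm (Fin 3)) (e : Fin 3 → ℤˣ) (he : e 0 * e 1 * e 2 = 1) :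
    ∃ x, ∀ i j, conjHom x (gen i j) = ((e i * e j : ℤˣ) : ℤ) • gen (p i) (p j) := by
  obtain ⟨x, hx⟩ := exists_signedPerm_eq p e he
  exact ⟨x, fun i j => by rw [conjHom_gen, scalarMatrix_conj_apply hx]⟩

theorem kleinSign_mul_skewMat : ∀ k l i j, l ≠ k →
    ((kleinSign l i * kleinSign l j : ℤˣ) : ℤ) * skewMat k i j = -skewMat k i j := by decide

/-- Diagonal conjugations change the sign of the skew-primitive functionals. -/
theorem exists_conjHom_skewFun_neg {k l : Fin 3} (hkl : l ≠ k) : ∃ x,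
    (∀ i j, conjHom x (gen i j) = ((kleinSign l i * kleinSign l j : ℤˣ) : ℤ) • gen i j) ∧
    ∀ y, skewFun k (conjHom x y) = -skewFun k y := by
  obtain ⟨x, hx⟩ := exists_conjHom_gen 1 (kleinSign l) (kleinSign_prod l)
  refine ⟨x, hx, fun y => ?_⟩
  have hχ : ∀ y, kleinChar k (conjHom x y) = kleinChar k y := by
    intro y
    rw [← AlgHom.comp_apply]
    congr 1
    ext i j
    rw [AlgHom.comp_apply, hx, map_zsmul, Equiv.Perm.one_apply, Equiv.Perm.one_apply]
    by_cases hij : i = j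
    · subst hij
      rw [Int.units_mul_self, Units.val_one, one_smul]
    · rw [kleinChar_gen, if_neg hij, smul_zero]
  have h : skewFun k ∘ₗ (conjHom x).toLinearMap = -skewFun k := by
    refine skew_ext (kleinChar k) (fun a b => ?_) (fun a b => ?_) fun i j => ?_
    · simp only [LinearMap.comp_apply, AlgHom.toLinearMap_apply, map_mul, skewFun_mul,
        counitHom_conjHom, hχ]
    · simp only [LinearMap.neg_apply, skewFun_mul]
      ring
    · rw [LinearMap.comp_apply, AlgHom.toLinearMap_apply, hx, map_zsmul, LinearMap.neg_apply,
        Equiv.Perm.one_apply, Equiv.Perm.one_apply, skewFun_gen, zsmul_eq_mul, ← Int.cast_mul,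
        kleinSign_mul_skewMat k l i j hkl, Int.cast_neg]
  exact LinearMap.congr_fun h y

/-- Conjugations by permutation matrices permute the skew-primitive functionals. -/
theorem exists_conjHom_skewFun_perm (p : Equiv.Perm (Fin 3)) : ∃ x,
    (∀ i j, conjHom x (gen i j) = gen (p i) (p j)) ∧
    ∀ k y, skewFun (p k) (conjHom x y) = skewFun k y := by
  obtain ⟨x, hx⟩ := exists_conjHom_gen p 1 (by decide)
  simp only [Pi.one_apply, mul_one, Units.val_one, one_smul] at hx
  refine ⟨x, hx, fun k y => ?_⟩
  have hχ : ∀ y, kleinChar (p k) (conjHom x y) = kleinChar k y := by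
    intro y
    rw [← AlgHom.comp_apply]
    congr 1
    ext i j
    rw [AlgHom.comp_apply, hx, kleinChar_gen, kleinChar_gen]
    simp [kleinSign]
  have h : skewFun (p k) ∘ₗ (conjHom x).toLinearMap = skewFun k := by
    refine skew_ext (kleinChar k) (fun a b => ?_) (skewFun_mul k) fun i j => ?_
    · simp only [LinearMap.comp_apply, AlgHom.toLinearMap_apply, map_mul, skewFun_mul,
        counitHom_conjHom, hχ]
    · rw [LinearMap.comp_apply, AlgHom.toLinearMap_apply, hx, skewFun_gen, skewFun_gen]
      simp [skewMat]
  exact LinearMap.congr_fun h y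

/-- An automorphism fixing all characters is the identity. -/
theorem eq_one_of_fixes_characters {θ : PolSOm3 ≃ₐ[ℂ] PolSOm3}
    (hθ : ∀ x, comulHom (θ x) = TensorProduct.map θ.toLinearMap θ.toLinearMap (comulHom x))
    (hχ : ∀ χ : PolSOm3 →ₐ[ℂ] ℂ, χ.comp θ.toAlgHom = χ) : θ = 1 := by
  have hχ' : ∀ (χ : PolSOm3 →ₐ[ℂ] ℂ) x, χ (θ x) = χ x := fun χ x => DFunLike.congr_fun (hχ χ) x
  have hconj : ∀ x y, θ (conjHom x y) = conjHom x (θ y) := by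
    intro x y
    rw [conjHom_eq_transl, AlgHom.comp_apply, AlgHom.comp_apply, translR_apply hθ (hχ _),
      translL_apply hθ (hχ _)]
  set α := skewFun 0 (θ (gen 1 2)) with hα
  have hgen : ∀ k i j, skewFun k (θ (gen i j)) = α * skewMat k i j := by
    intro k i j
    -- Either some diagonal conjugation fixes a_ij and negates X_k, so both sides vanish, or (k, i,
    -- j) is a permutation of (0, 1, 2) and a permutation matrix carries the claim to the definition
    -- of α.
    have h1 : ∀ k i j, (∃ l, l ≠ k ∧ kleinSign l i * kleinSign l j = 1) ∨
      ∃ p : Equiv.Perm (Fin 3), p 0 = k ∧ p 1 = i ∧ p 2 = j := by decide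
    have h4 : ∀ p : Equiv.Perm (Fin 3), skewMat (p 0) (p 1) (p 2) = 1 := by decide
    rcases h1 k i j with ⟨l, hl, hs⟩ | ⟨p, rfl, rfl, rfl⟩
    · obtain ⟨x, hx, hx'⟩ := exists_conjHom_skewFun_neg hl
      have h2 := hx' (θ (gen i j))
      rw [← hconj, hx, hs, Units.val_one, one_smul] at h2
      have h3 := kleinSign_mul_skewMat k l i j hl
      rw [hs, Units.val_one, one_mul] at h3
      rw [self_eq_neg.1 h3, Int.cast_zero, mul_zero]
      exact self_eq_neg.1 h2
    · obtain ⟨x, hx, hx'⟩ := exists_conjHom_skewFun_perm p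
      have h2 := hx' 0 (θ (gen 1 2))
      rw [← hconj, hx] at h2
      rw [h4, Int.cast_one, mul_one, h2]
  have hskew : ∀ k, skewFun k ∘ₗ θ.toLinearMap = α • skewFun k := by
    intro k
    refine skew_ext (kleinChar k) (fun a b => ?_) (fun a b => ?_) fun i j => ?_
    · simp only [LinearMap.comp_apply, AlgEquiv.toLinearMap_apply, map_mul, skewFun_mul, hχ']
    · simp only [LinearMap.smul_apply, skewFun_mul, smul_eq_mul]
      ring
    · simp only [LinearMap.comp_apply, AlgEquiv.toLinearMap_apply, LinearMap.smul_apply, hgen,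
        skewFun_gen, smul_eq_mul]
  have hder : ∀ k x, skewDer k (θ x) = α • θ (skewDer k x) := by
    intro k x
    rw [skewDer, transl_apply hθ, hskew]
    simp [transl, LinearMap.lTensor_smul]
  have hα0 : α ≠ 0 := by
    intro h0
    have h1 := LinearMap.congr_fun (hskew 0) (θ.symm (gen 1 2))
    rw [LinearMap.comp_apply, AlgEquiv.toLinearMap_apply, AlgEquiv.apply_symm_apply, h0, zero_smul,
      skewFun_gen] at h1
    simp [skewMat] at h1
  -- Both sides of the anticommutator relation are evaluated on θ(a_21); applying ε leaves α² = α.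
  have hα1 : α = 1 := by
    have h1 := skewDer_anticommutator (i := 1) (j := 2) (k := 0) (by decide) (by decide)
      (by decide) (θ (gen 2 1))
    rw [hder, hder, hder, map_smul, map_smul, hder, hder, ← smul_add, ← smul_add, ← map_add,
      skewDer_anticommutator (i := 1) (j := 2) (k := 0) (by decide) (by decide) (by decide)] at h1
    have h2 := congrArg counitHom h1
    have h3 : counitHom (skewDer 0 (gen 2 1)) = 1 := by
      rw [skewDer_gen]
      simp [Fin.sum_univ_three, skewMat]
    rw [map_smul, map_smul, hχ', h3, smul_eq_mul, smul_eq_mul, mul_one] at h2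
    exact mul_left_cancel₀ hα0 (h2.trans (mul_one α).symm)
  have hmem : ∀ y ∈ LinearMap.range (θ.toLinearMap - LinearMap.id), y = 0 := by
    refine eq_zero_of_mem_of_skewDer_mem _ ?_ ?_ ?_
    · rintro k _ ⟨x, rfl⟩
      refine ⟨skewDer k x, ?_⟩
      simp [hder, hα1]
    · rintro _ ⟨x, rfl⟩
      simp [hχ']
    · rintro k _ ⟨x, rfl⟩
      simp [hχ']
  ext x
  exact sub_eq_zero.1 (hmem _ ⟨x, rfl⟩)

/-- Precomposing characters with θ is an injective endomorphism of S_4, hence conjugation by some z;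
composing θ with `conjAut z` undoes it on characters. -/
theorem conjAut_surjective : Function.Surjective conjAut := by
  intro θ
  have hθ : ∀ x, comulHom (θ.1 x) =
      TensorProduct.map θ.1.toLinearMap θ.1.toLinearMap (comulHom x) := θ.2.1
  choose α hα using fun x => exists_permChar_eq ((permChar x).comp θ.1.toAlgHom)
  have hmul : ∀ x y, α (x * y) = α x * α y := by
    intro x y
    apply permChar_injective
    rw [← hα, ← convChar_permChar, ← convChar_permChar, ← hα, ← hα, convChar_comp hθ]
  have hinj : Function.Injective α := by
    intro x y hxy
    apply permChar_injective
    have h1 := hα x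
    rw [hxy, ← hα y] at h1
    refine AlgHom.ext fun a => ?_
    have h2 := DFunLike.congr_fun h1 (θ.1.symm a)
    simpa using h2
  obtain ⟨z, hz⟩ := perm_hom_eq_conj (MonoidHom.mk' α hmul) hinj
  have hone : (θ * conjAut z).1 = 1 := by
    refine eq_one_of_fixes_characters (θ * conjAut z).2.1 fun χ => ?_
    obtain ⟨x, rfl⟩ := exists_permChar_eq χ
    have h1 : (permChar x).comp (θ * conjAut z).1.toAlgHom =
        ((permChar x).comp θ.1.toAlgHom).comp (conjHom z) := rfl
    have h2 : α x = z * x * z⁻¹ := hz x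
    rw [h1, hα, permChar_conjHom, h2]
    congr 1
    group
  refine ⟨z⁻¹, ?_⟩
  rw [map_inv]
  exact (eq_inv_of_mul_eq_one_left (Subtype.ext hone)).symm

theorem map_gen_conjAut (x : Equiv.Perm (Fin 4)) :
    gen.map (fun a => (conjAut x).1 a) =
      (scalarMatrix (stdRep x).1)ᵀ * gen * scalarMatrix (stdRep x).1 := by
  ext i j
  exact conjHom_gen x i j

end PolSOm3

theorem mainTheorem2 :
    (∀ θ : hopfStarAut PolSOm3, ∃ x : Equiv.Perm (Fin 4),
      PolSOm3.gen.map (fun a => θ.1 a) =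
        (PolSOm3.scalarMatrix (stdRep x).1)ᵀ * PolSOm3.gen *
          PolSOm3.scalarMatrix (stdRep x).1) ∧
    ∃ Φ : Equiv.Perm (Fin 4) ≃* hopfStarAut PolSOm3, ∀ x : Equiv.Perm (Fin 4),
      PolSOm3.gen.map (fun a => (Φ x).1 a) =
        (PolSOm3.scalarMatrix (stdRep x).1)ᵀ * PolSOm3.gen *
          PolSOm3.scalarMatrix (stdRep x).1 := by
  refine ⟨fun θ => ?_, MulEquiv.ofBijective PolSOm3.conjAut
    ⟨PolSOm3.conjAut_injective, PolSOm3.conjAut_surjective⟩, PolSOm3.map_gen_conjAut⟩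
  obtain ⟨x, rfl⟩ := PolSOm3.conjAut_surjective θ
  exact ⟨x, PolSOm3.map_gen_conjAut x⟩
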